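/- **Setting.** Running time is measured for deterministic algorithms on a random access machine with logarithmic cost (equivalently, up to polylogarithmic factors, a word RAM with $O(\log n)$-bit words). In the 3-SUM problem one is given three finite sets of integers $S_1,S_2,S_3\subseteq[-n^6,n^6]$, where $n=|S_1|+|S_2|+|S_3|\ge 1$, and has to decide whether there are $x_i\in S_i$ with $x_1+x_2+x_3=0$. The 3-SUM Hypothesis states that for every $\varepsilon>0$ no algorithm solves this problem in time $O(n^{2-\varepsilon})$. For $a,b,c\in\{0,1\}^D$ let $\langle a,b,c\rangle=\sum_{j=1}^D a_jb_jc_j$. **Theorem.** Assume the 3-SUM Hypothesis. Then there are functions $D:\mathbb N\to\mathbb N$ and $\eta:\mathbb N\to\mathbb R$ with $D(N)=N^{o(1)}$ and $\eta(N)=o(1)$ as $N\to\infty$ such that, for every $\varepsilon>0$, no algorithm running in time $O(N^{2-\varepsilon})$ can, given three collections $A,B,C$, each of $N\ge 2$ vectors in $\{0,1\}^{D}$ with $D=D(N)$, and an integer $s$ with $1\le s\le D$, distinguish between the following two cases: - (Completeness) there exist $a\in A$, $b\in B$, $c\in C$ such that $\langle a,b,c\rangle\ge s$; - (Soundness) for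 all $a\in A$, $b\in B$, $c\in C$, $\langle a,b,c\rangle\le s/2^{(\log_2 N)^{1-\eta(N)}}$. -/

import Mathlib

open Filter Topology

/-! ## Machine model: random access machines with logarithmic cost

Registers and memory cells hold integers, and each operation is charged the bit length of the
numbers it handles. Up to polylogarithmic factors, which do not matter for statements about running
times `O(n ^ (2 - ε))` for every `ε > 0`, this is the word RAM with words of `O(log n)` bits.
Programs are deterministic, with structured control flow. -/

namespace RAM

/-- Machine states: registers, numbered by naturals, and memory cells, addressed by integers. -/
structure State where
  reg : ℕ → ℤ
  mem : ℤ → ℤ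

/-- Primitive binary operations. -/
inductive Op
  | add | sub | mul | div | mod | lt | eq

/-- Value of a primitive operation: `div`, `mod` are Euclidean division and remainder (with the
convention `x / 0 = 0`, `x % 0 = x`), comparisons return `1` for true and `0` for false. -/
def Op.apply : Op → ℤ → ℤ → ℤ
  | .add, x, y => x + y
  | .sub, x, y => x - y
  | .mul, x, y => x * y
  | .div, x, y => x / y
  | .mod, x, y => x % y
  | .lt, x, y => if x < y then 1 else 0
  | .eq, x, y => if x = y then 1 else 0

/-- Expressions: constants, registers, (indirect) memory reads and operations. -/
inductive Expr
  | lit (z : ℤ)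
  | reg (i : ℕ)
  | read (address : Expr)
  | bin (op : Op) (e f : Expr)

/-- Value of an expression in a state. -/
def Expr.val (σ : State) : Expr → ℤ
  | .lit z => z
  | .reg i => σ.reg i
  | .read a => σ.mem (a.val σ)
  | .bin op e f => op.apply (e.val σ) (f.val σ)

/-- Number of binary digits of the absolute value of an integer. -/
def bitLength (z : ℤ) : ℕ := z.natAbs.size

/-- Logarithmic cost of evaluating an expression: each of its nodes costs one plus the bit length
of its value (so operands, results, addresses and the contents read are all charged). -/
def Expr.cost (σ : State) : Expr → ℕ
  | .lit z => 1 + bitLength z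
  | .reg i => 1 + bitLength (σ.reg i)
  | .read a => a.cost σ + 1 + bitLength (σ.mem (a.val σ))
  | .bin op e f => e.cost σ + f.cost σ + 1 + bitLength (op.apply (e.val σ) (f.val σ))

/-- Programs. -/
inductive Prog
  /-- do nothing -/
  | skip
  /-- write the value of `e` to register `i` -/
  | assign (i : ℕ) (e : Expr)
  /-- write the value of `e` to the memory cell with address `a` -/
  | write (a e : Expr)
  /-- sequential composition -/
  | seq (p q : Prog)
  /-- if `c` is nonzero then `p` else `q` -/
  | cond (c : Expr) (p q : Prog)
  /-- while `c` is nonzero, repeat `p` -/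
  | loop (c : Expr) (p : Prog)

/-- `Exec p σ τ t`: started in state `σ`, program `p` halts in state `τ` after total cost `t`. -/
inductive Exec : Prog → State → State → ℕ → Prop
  | skip (σ : State) : Exec .skip σ σ 1
  | assign (i : ℕ) (e : Expr) (σ : State) :
      Exec (.assign i e) σ { σ with reg := Function.update σ.reg i (e.val σ) } (e.cost σ)
  | write (a e : Expr) (σ : State) :
      Exec (.write a e) σ { σ with mem := Function.update σ.mem (a.val σ) (e.val σ) }
        (a.cost σ + e.cost σ)
  | seq {p q : Prog} {σ τ υ : State} {t u : ℕ} :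
      Exec p σ τ t → Exec q τ υ u → Exec (.seq p q) σ υ (t + u)
  | cond_true {c : Expr} {p q : Prog} {σ τ : State} {t : ℕ} :
      c.val σ ≠ 0 → Exec p σ τ t → Exec (.cond c p q) σ τ (c.cost σ + t)
  | cond_false {c : Expr} {p q : Prog} {σ τ : State} {t : ℕ} :
      c.val σ = 0 → Exec q σ τ t → Exec (.cond c p q) σ τ (c.cost σ + t)
  | loop_true {c : Expr} {p : Prog} {σ τ υ : State} {t u : ℕ} :
      c.val σ ≠ 0 → Exec p σ τ t → Exec (.loop c p) τ υ u →
        Exec (.loop c p) σ υ (c.cost σ + t + u)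
  | loop_false {c : Expr} {p : Prog} {σ : State} :
      c.val σ = 0 → Exec (.loop c p) σ σ (c.cost σ)

/-- Initial state on an input list: the list is in the cells `0, 1, 2, …`, all else is zero. -/
def init (input : List ℤ) : State where
  reg := fun _ => 0
  mem := fun a => if 0 ≤ a then input.getD a.toNat 0 else 0

/-- On the given input, `p` halts at cost at most `T` with a nonzero number in register `0`. -/
def AcceptsWithin (p : Prog) (input : List ℤ) (T : ℝ) : Prop :=
  ∃ (τ : State) (t : ℕ), Exec p (init input) τ t ∧ (t : ℝ) ≤ T ∧ τ.reg 0 ≠ 0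

/-- On the given input, `p` halts at cost at most `T` with zero in register `0`. -/
def RejectsWithin (p : Prog) (input : List ℤ) (T : ℝ) : Prop :=
  ∃ (τ : State) (t : ℕ), Exec p (init input) τ t ∧ (t : ℝ) ≤ T ∧ τ.reg 0 = 0

end RAM

/-! ## The 3-SUM Hypothesis -/

/-- The input of a 3-SUM instance: the three cardinalities, then the elements. -/
def threeSumInput (S₁ S₂ S₃ : List ℤ) : List ℤ :=
  [(S₁.length : ℤ), (S₂.length : ℤ), (S₃.length : ℤ)] ++ S₁ ++ S₂ ++ S₃

/-- Program `p` solves 3-SUM in time `T n`, where `n ≥ 1` is the total number of input integers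
and the integers lie in `[-n ^ 6, n ^ 6]`. The three sets are given as lists without repetition. -/
def SolvesThreeSum (p : RAM.Prog) (T : ℕ → ℝ) : Prop :=
  ∀ (n : ℕ) (S₁ S₂ S₃ : List ℤ), 1 ≤ n → S₁.length + S₂.length + S₃.length = n →
    S₁.Nodup → S₂.Nodup → S₃.Nodup →
    (∀ x ∈ S₁ ++ S₂ ++ S₃, |x| ≤ (n : ℤ) ^ 6) →
      ((∃ x ∈ S₁, ∃ y ∈ S₂, ∃ z ∈ S₃, x + y + z = 0) →
        RAM.AcceptsWithin p (threeSumInput S₁ S₂ S₃) (T n)) ∧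
      ((¬ ∃ x ∈ S₁, ∃ y ∈ S₂, ∃ z ∈ S₃, x + y + z = 0) →
        RAM.RejectsWithin p (threeSumInput S₁ S₂ S₃) (T n))

/-- The 3-SUM Hypothesis: for no `ε > 0` can 3-SUM be solved in time `O(n ^ (2 - ε))`, even for
integers of absolute value at most `n ^ 6`. -/
def ThreeSumHypothesis : Prop :=
  ∀ ε : ℝ, 0 < ε →
    ¬ ∃ (p : RAM.Prog) (C : ℝ), SolvesThreeSum p (fun n => C * (n : ℝ) ^ (2 - ε))

/-! ## Trichromatic maximum inner product -/

/-- Inner product of three 0/1 vectors: the sum of the products of corresponding coordinates. -/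
def tripleInner {D : ℕ} (a b c : Fin D → Bool) : ℕ :=
  ∑ j : Fin D, (a j).toNat * (b j).toNat * (c j).toNat

/-- The coordinates of a collection of vectors, vector after vector. -/
def vectorEntries {N D : ℕ} (A : Fin N → Fin D → Bool) : List ℤ :=
  (List.ofFn fun i => List.ofFn fun j => ((A i j).toNat : ℤ)).flatten

/-- The input of a trichromatic maximum inner product instance. -/
def mipInput {N D : ℕ} (A B C : Fin N → Fin D → Bool) (s : ℕ) : List ℤ :=
  [(N : ℤ), (D : ℤ), (s : ℤ)] ++ vectorEntries A ++ vectorEntries B ++ vectorEntries C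

/-- In time `T N`, program `p` distinguishes, given three collections of `N ≥ 2` vectors in
`{0,1} ^ (D N)` and an integer `1 ≤ s ≤ D N`, between the instances where some triple has inner
product at least `s` (accepted) and those where all triples have inner product at most
`s / gap N` (rejected). Nothing is required on other instances. -/
def DistinguishesGapMIP (p : RAM.Prog) (D : ℕ → ℕ) (gap T : ℕ → ℝ) : Prop :=
  ∀ (N : ℕ) (A B C : Fin N → Fin (D N) → Bool) (s : ℕ), 2 ≤ N → 1 ≤ s → s ≤ D N →
    ((∃ i j k, s ≤ tripleInner (A i) (B j) (C k)) →
      RAM.AcceptsWithin p (mipInput A B C s) (T N)) ∧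
    ((∀ i j k, (tripleInner (A i) (B j) (C k) : ℝ) ≤ (s : ℝ) / gap N) →
      RAM.RejectsWithin p (mipInput A B C s) (T N))

/-! The equation `x + y + z = 0` is replaced by congruences modulo many primes at once. A coordinate
is a triple `(q, u, v)`: a modulus and two residues. For prime `q`, the vector of `x ∈ S₁` has a one
there if `x ≡ u`, that of `y ∈ S₂` if `y ≡ v`, and that of `z ∈ S₃` if `z + u + v ≡ 0` modulo `q`;
for composite `q` all entries vanish. Given `x` and `y`, the modulus determines `u` and `v`, so the
inner product counts the primes `q` in range that divide `x + y + z`. If the sum is zero, all primes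
up to `Q = 4 ^ l` count, and a Chebyshev bound gives at least `2 ^ l` of them
(`exists_primeCounting_le_tripleInner`, `two_pow_le_primeCounting_four_pow`). Otherwise only prime
divisors of a nonzero integer of size at most `4 * N ^ 6` count, hence at most `6 * L + 2` when `N =
2 ^ L` (`tripleInner_le_of_forall_ne`).

With `l = ⌊L / log L⌋` the dimension `Q ^ 3 = 2 ^ (6 * l)` is `N ^ o(1)` and writing the vectors
takes time `N ^ (1 + o(1))`, while the ratio `2 ^ l / (6 * L + 2)` still has exponent `L ^ (1 -
o(1))` (`tendsto_dimExponent`, `reduction_cost_le`, `le_two_pow_div_gap`).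

The rest is program verification. `RAM.reduction` transforms the initial state of a 3-SUM instance
into exactly the initial state of the vector instance (`RAM.runs_reduction`), so a distinguisher can
be appended to it. Costs are found by counting elementary steps: all values stay below one bound
`X`, hence each step costs at most a fixed multiple of the bit length of `X`. Rounding the number of
vectors up to a power of two that is at least `2 ^ L₀` makes the asymptotic inequalities valid for
every `n`, at the price of a constant factor (`solvesThreeSum_of_distinguishesGapMIP`). -/

namespace RAM

/-! ## Cost of expressions in bounded states -/

/-- All registers and memory cells have absolute value at most `X`. -/
def State.Bounded (X : ℕ) (σ : State) : Prop :=
  (∀ i, (σ.reg i).natAbs ≤ X) ∧ ∀ a, (σ.mem a).natAbs ≤ X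

/-- In a state bounded by `X ≥ 2`, the value of `e` is at most `X ^ e.degree`. -/
def Expr.degree : Expr → ℕ
  | .lit z => z.natAbs
  | .reg _ => 1
  | .read _ => 1
  | .bin _ e f => e.degree + f.degree + 1

/-- In a state bounded by `X ≥ 2`, evaluating `e` costs at most `e.weight` times the bit length
of `X`. -/
def Expr.weight : Expr → ℕ
  | .lit z => 1 + z.natAbs
  | .reg _ => 2
  | .read a => a.weight + 2
  | .bin op e f => e.weight + f.weight + (1 + (Expr.bin op e f).degree)

theorem Op.natAbs_apply_le (op : Op) (x y : ℤ) :
    (op.apply x y).natAbs ≤ max (x.natAbs + y.natAbs) (max (x.natAbs * y.natAbs) 1) := by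
  cases op <;> simp only [Op.apply]
  · omega
  · omega
  · simp [Int.natAbs_mul]
  · have := Int.natAbs_ediv_le_natAbs x y
    omega
  · rcases eq_or_ne y 0 with rfl | hy
    · simp
    · have h1 := Int.emod_nonneg x hy
      have h2 := Int.emod_lt_abs x hy
      rw [Int.abs_eq_natAbs] at h2
      omega
  · split_ifs <;> simp
  · split_ifs <;> simp

/-- Sums and products of `X ^ a` and `X ^ b` are at most `2 * X ^ (a + b) ≤ X ^ (a + b + 1)`; this
is the extra one in `Expr.degree`. The exponent depends on the syntax alone, so bit lengths grow
only by a constant factor. -/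
theorem Expr.natAbs_val_le {X : ℕ} (hX : 2 ≤ X) {σ : State} (hσ : σ.Bounded X) (e : Expr) :
    (e.val σ).natAbs ≤ X ^ e.degree := by
  induction e with
  | lit z =>
    exact Nat.lt_two_pow_self.le.trans (Nat.pow_le_pow_left hX _)
  | reg i => simpa [Expr.val, Expr.degree] using hσ.1 i
  | read a _ => simpa [Expr.val, Expr.degree] using hσ.2 _
  | bin op e f he hf =>
    have hX0 : 0 < X := by omega
    have h1 : 1 ≤ X ^ e.degree := Nat.one_le_pow _ _ hX0
    have h2 : 1 ≤ X ^ f.degree := Nat.one_le_pow _ _ hX0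
    refine (Op.natAbs_apply_le op _ _).trans ?_
    have hm := Nat.mul_le_mul he hf
    have hs : X ^ e.degree + X ^ f.degree ≤ X ^ e.degree * X ^ f.degree * 2 := by nlinarith
    have ht : X ^ e.degree * X ^ f.degree * 2 ≤ X ^ (e.degree + f.degree + 1) := by
      rw [pow_succ, pow_add]
      exact Nat.mul_le_mul_left _ hX
    have h3 : 1 ≤ X ^ e.degree * X ^ f.degree := Nat.mul_pos h1 h2
    simp only [Expr.degree]
    refine max_le (by omega) (max_le (by omega) (by omega))

theorem bitLength_le_of_natAbs_le_pow {X d : ℕ} {z : ℤ} (h : z.natAbs ≤ X ^ d) (hd : 1 ≤ d) :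
    bitLength z ≤ d * X.size := by
  rw [bitLength, Nat.size_le, mul_comm, pow_mul]
  exact h.trans_lt (Nat.pow_lt_pow_left (Nat.lt_size_self X) (by omega))

theorem Expr.cost_le {X : ℕ} (hX : 2 ≤ X) {σ : State} (hσ : σ.Bounded X) (e : Expr) :
    e.cost σ ≤ e.weight * X.size := by
  have hw : 1 ≤ X.size := Nat.size_pos.2 (by omega)
  induction e with
  | lit z =>
    have : bitLength z ≤ z.natAbs * X.size := by
      rcases eq_or_ne z 0 with rfl | hz
      · simp [bitLength]
      · exact bitLength_le_of_natAbs_le_pow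
          (Nat.lt_two_pow_self.le.trans (Nat.pow_le_pow_left hX _)) (by omega)
    simp only [Expr.cost, Expr.weight]
    nlinarith
  | reg i =>
    have : bitLength (σ.reg i) ≤ 1 * X.size :=
      bitLength_le_of_natAbs_le_pow (by simpa using hσ.1 i) le_rfl
    simp only [Expr.cost, Expr.weight]
    omega
  | read a ha =>
    have : bitLength (σ.mem (a.val σ)) ≤ 1 * X.size :=
      bitLength_le_of_natAbs_le_pow (by simpa using hσ.2 _) le_rfl
    simp only [Expr.cost, Expr.weight]
    nlinarith
  | bin op e f he hf =>
    have := bitLength_le_of_natAbs_le_pow (Expr.natAbs_val_le hX hσ (.bin op e f))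
      (by simp [Expr.degree])
    rw [Expr.val] at this
    simp only [Expr.cost, Expr.weight]
    nlinarith

/-! ## Executions with a bounded number of elementary steps -/

/-- The state whose first registers hold `l` (the others being zero), with memory `m`. -/
def stateOf (l : List ℤ) (m : ℤ → ℤ) : State where
  reg := fun i => l.getD i 0
  mem := m

theorem bounded_stateOf {X : ℕ} {l : List ℤ} {m : ℤ → ℤ} (hl : ∀ x ∈ l, x.natAbs ≤ X)
    (hm : ∀ a, (m a).natAbs ≤ X) : (stateOf l m).Bounded X := by
  refine ⟨fun i => ?_, hm⟩
  simp only [stateOf, List.getD_eq_getElem?_getD]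
  rcases lt_or_ge i l.length with hi | hi
  · simpa [hi] using hl _ (List.getElem_mem hi)
  · simp [hi]

/-- Started in `σ`, program `p` halts in `τ` at cost at most `k * U`. -/
def Runs (U : ℕ) (p : Prog) (σ τ : State) (k : ℕ) : Prop :=
  ∃ t, Exec p σ τ t ∧ t ≤ k * U

theorem Runs.mono {U p σ τ k k'} (h : Runs U p σ τ k) (hk : k ≤ k') : Runs U p σ τ k' := by
  obtain ⟨t, h, ht⟩ := h
  exact ⟨t, h, ht.trans (Nat.mul_le_mul_right _ hk)⟩

theorem Runs.seq {U p q σ τ υ j k} (hp : Runs U p σ τ j) (hq : Runs U q τ υ k) :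
    Runs U (.seq p q) σ υ (j + k) := by
  obtain ⟨t, hp, ht⟩ := hp
  obtain ⟨u, hq, hu⟩ := hq
  exact ⟨t + u, .seq hp hq, by rw [add_mul]; omega⟩

theorem Runs.assign_of_cost {U : ℕ} {l l' : List ℤ} {m : ℤ → ℤ} {i : ℕ} {e : Expr}
    (hc : e.cost (stateOf l m) ≤ U) (hi : i < l.length)
    (hl : l.set i (e.val (stateOf l m)) = l') :
    Runs U (.assign i e) (stateOf l m) (stateOf l' m) 1 := by
  have h := Exec.assign i e (stateOf l m)
  have hs : stateOf l' m = { stateOf l m with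
      reg := Function.update (stateOf l m).reg i (e.val (stateOf l m)) } := by
    subst hl
    simp only [stateOf, State.mk.injEq, and_true]
    funext j
    rcases eq_or_ne j i with rfl | hj
    · simp [hi]
    · simp [Function.update_of_ne hj, List.getElem?_set_ne hj.symm]
  rw [hs]
  exact ⟨_, h, by simpa using hc⟩

theorem Runs.assign {X U : ℕ} (hX : 2 ≤ X) {l l' : List ℤ} {m : ℤ → ℤ} {i : ℕ} {e : Expr}
    (hb : (stateOf l m).Bounded X) (hU : e.weight * X.size ≤ U) (hi : i < l.length)
    (hl : l.set i (e.val (stateOf l m)) = l') :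
    Runs U (.assign i e) (stateOf l m) (stateOf l' m) 1 :=
  .assign_of_cost ((e.cost_le hX hb).trans hU) hi hl

theorem Runs.write {X U : ℕ} (hX : 2 ≤ X) {l : List ℤ} {m m' : ℤ → ℤ} {a e : Expr}
    (hb : (stateOf l m).Bounded X) (hU : (a.weight + e.weight) * X.size ≤ U)
    (hm : Function.update m (a.val (stateOf l m)) (e.val (stateOf l m)) = m') :
    Runs U (.write a e) (stateOf l m) (stateOf l m') 1 := by
  subst hm
  refine ⟨_, Exec.write a e (stateOf l m), ?_⟩
  have h1 := a.cost_le hX hb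
  have h2 := e.cost_le hX hb
  rw [add_mul] at hU
  omega

/-- `S i` is the state after `i` rounds; giving it as an explicit function replaces a loop
invariant. Each round pays `b` for the body and one for the guard, and the last guard pays the final
one. -/
theorem Runs.loop {U : ℕ} {c : Expr} {p : Prog} (S : ℕ → State) (j b : ℕ)
    (hc : ∀ i ≤ j, c.cost (S i) ≤ U) (hv : ∀ i < j, c.val (S i) ≠ 0) (h0 : c.val (S j) = 0)
    (hp : ∀ i < j, Runs U p (S i) (S (i + 1)) b) :
    Runs U (.loop c p) (S 0) (S j) (j * (b + 1) + 1) := by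
  induction j generalizing S with
  | zero => exact ⟨_, .loop_false h0, by simpa using hc 0 le_rfl⟩
  | succ j ih =>
    obtain ⟨t, h1, ht⟩ := hp 0 (by omega)
    obtain ⟨u, h2, hu⟩ := ih (fun i => S (i + 1)) (fun i hi => hc _ (by omega))
      (fun i hi => hv _ (by omega)) h0 (fun i hi => hp _ (by omega))
    refine ⟨_, .loop_true (hv 0 (by omega)) h1 h2, ?_⟩
    have := hc 0 (by omega)
    calc _ ≤ U + b * U + (j * (b + 1) + 1) * U := by omega
      _ = _ := by ring

theorem Runs.exec_seq {U p q σ τ υ k t} (hp : Runs U p σ τ k) (hq : Exec q τ υ t) :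
    ∃ u, Exec (.seq p q) σ υ u ∧ u ≤ k * U + t := by
  obtain ⟨u, hp, hu⟩ := hp
  exact ⟨u + t, .seq hp hq, by omega⟩

/-- Overwrite the `n` cells of `m` from `d` on by the values of `F`. -/
def fillMem (d : ℤ) (n : ℕ) (F : ℕ → ℤ) (m : ℤ → ℤ) : ℤ → ℤ :=
  fun a => if d ≤ a ∧ a < d + n then F (a - d).toNat else m a

theorem fillMem_zero (d : ℤ) (F : ℕ → ℤ) (m : ℤ → ℤ) : fillMem d 0 F m = m := by
  funext a
  simp only [fillMem]
  rw [if_neg]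
  simp

/-- The induction step for all loops that write consecutive cells. -/
theorem update_fillMem (d : ℤ) (n : ℕ) (F : ℕ → ℤ) (m : ℤ → ℤ) :
    Function.update (fillMem d n F m) (d + n) (F n) = fillMem d (n + 1) F m := by
  funext a
  rcases eq_or_ne a (d + n) with rfl | ha
  · simp [fillMem]
  · rw [Function.update_of_ne ha]
    have : (d ≤ a ∧ a < d + n) ↔ (d ≤ a ∧ a < d + ((n + 1 : ℕ) : ℤ)) := by
      push_cast
      omega
    simp only [fillMem, this]

theorem natAbs_fillMem_le {X : ℕ} {d : ℤ} {n : ℕ} {F : ℕ → ℤ} {m : ℤ → ℤ}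
    (hF : ∀ i < n, (F i).natAbs ≤ X) (hm : ∀ a, (m a).natAbs ≤ X) (a : ℤ) :
    (fillMem d n F m a).natAbs ≤ X := by
  simp only [fillMem]
  split_ifs with h
  · exact hF _ (by omega)
  · exact hm a

end RAM

/-! ### Counting primes and prime divisors -/

/-- Chebyshev's argument: with `2 * n = 4 ^ l`, each prime power in `n.centralBinom` is at most `2 *
n`, so `4 ^ n / n < n.centralBinom ≤ (2 * n) ^ π(2 * n)`. -/
theorem two_pow_le_primeCounting_four_pow {l : ℕ} (hl : 2 ≤ l) :
    2 ^ l ≤ Nat.primeCounting (4 ^ l) := by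
  obtain ⟨n, hn⟩ : ∃ n, 4 ^ l = 2 * n := ⟨2 * 4 ^ (l - 1), by
    obtain ⟨l, rfl⟩ : ∃ j, l = j + 1 := ⟨l - 1, by omega⟩
    simp only [pow_succ, Nat.add_sub_cancel]
    ring⟩
  have h16 : 4 ^ 2 ≤ 4 ^ l := Nat.pow_le_pow_right (by norm_num) hl
  have hn4 : 4 ≤ n := by omega
  have h1 := Nat.four_pow_lt_mul_centralBinom n hn4
  have h2 : n.centralBinom ≤ (2 * n) ^ Nat.primeCounting (2 * n) := by
    rw [← Nat.prod_pow_factorization_centralBinom, Nat.primeCounting, Nat.primeCounting',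
      Nat.count_eq_card_filter_range]
    rw [← Finset.prod_filter_mul_prod_filter_not (Finset.range (2 * n + 1)) Nat.Prime]
    rw [Finset.prod_eq_one (s := Finset.filter (fun p => ¬ Nat.Prime p) _), mul_one]
    · refine Finset.prod_le_pow_card _ _ _ fun p _ => ?_
      exact Nat.pow_factorization_choose_le (by omega)
    · intro p hp
      rw [Nat.factorization_eq_zero_of_not_prime _ (Finset.mem_filter.1 hp).2, pow_zero]
  set r := Nat.primeCounting (4 ^ l) with hr
  rw [← hn, ← hr] at h2
  -- Everything is a power of two here, so comparing exponents replaces taking logarithms.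
  have h3 : 2 ^ (4 ^ l) < 2 ^ (2 * l * (r + 1)) := by
    calc 2 ^ (4 ^ l) = 4 ^ n := by rw [hn, pow_mul]; norm_num
      _ < n * n.centralBinom := h1
      _ ≤ 4 ^ l * (4 ^ l) ^ r := Nat.mul_le_mul (by omega) h2
      _ = 2 ^ (2 * l * (r + 1)) := by
        rw [show (4 : ℕ) = 2 ^ 2 by norm_num, ← pow_mul, ← pow_mul, ← pow_add]
        congr 1
        ring
  have h4 : 4 ^ l < 2 * l * (r + 1) := (Nat.pow_lt_pow_iff_right (by norm_num)).1 h3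
  have h5 : 2 * l ≤ 2 ^ l := by
    clear * - hl
    induction l, hl using Nat.le_induction with
    | base => norm_num
    | succ k hk ih => rw [pow_succ]; omega
  have h6 : (4 : ℕ) ^ l = 2 ^ l * 2 ^ l := by rw [← mul_pow]; norm_num
  by_contra! hlt
  have : 2 * l * (r + 1) ≤ 2 ^ l * 2 ^ l := Nat.mul_le_mul h5 hlt
  omega

/-- The product of the distinct prime factors divides `z`, and each of them is at least two. -/
theorem card_primeFactors_le_log (z : ℕ) (hz : z ≠ 0) : z.primeFactors.card ≤ Nat.log 2 z := by
  refine Nat.le_log_of_pow_le (by norm_num) ?_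
  refine le_trans ?_ (Nat.le_of_dvd (Nat.pos_of_ne_zero hz) (Nat.prod_primeFactors_dvd z))
  exact Finset.pow_card_le_prod _ _ _ fun p hp => (Nat.prime_of_mem_primeFactors hp).two_le

/-! ## Hashing integers modulo primes -/

/-- A test on a modulus, two residues and an integer. -/
abbrev ResidueTest := ℤ → ℤ → ℤ → ℤ → Bool

/-- `x` has the first residue. -/
def firstTest : ResidueTest := fun q u _ x => decide (x % q = u)

/-- `x` has the second residue. -/
def secondTest : ResidueTest := fun q _ v x => decide (x % q = v)

/-- `x` completes the two residues to zero. -/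
def thirdTest : ResidueTest := fun q u v x => decide ((x + u + v) % q = 0)

/-- The coordinates are the triples of a modulus in `[2, Q + 2)` and two residues in `[0, Q)`; this
is the modulus of coordinate `c`. -/
def coordModulus (Q c : ℕ) : ℕ := c / (Q * Q) + 2

/-- A coordinate number is written in base `Q`: its last two digits are the residues `v` and `u`,
and the rest is the modulus minus two. -/
theorem coord_injective {Q c c' : ℕ} (h : coordModulus Q c = coordModulus Q c')
    (hu : c / Q % Q = c' / Q % Q) (hv : c % Q = c' % Q) : c = c' := by
  simp only [coordModulus, Nat.add_right_cancel_iff, ← Nat.div_div_eq_div_mul] at h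
  have h1 : c / Q = c' / Q := by
    rw [← Nat.div_add_mod (c / Q) Q, ← Nat.div_add_mod (c' / Q) Q, h, hu]
  rw [← Nat.div_add_mod c Q, ← Nat.div_add_mod c' Q, h1, hv]

theorem coord_decode {Q r u v : ℕ} (hu : u < Q) (hv : v < Q) :
    coordModulus Q ((r * Q + u) * Q + v) = r + 2 ∧ ((r * Q + u) * Q + v) / Q % Q = u ∧
      ((r * Q + u) * Q + v) % Q = v := by
  have hQ : 0 < Q := by omega
  have h1 : ((r * Q + u) * Q + v) / Q = r * Q + u := by
    rw [mul_comm (r * Q + u) Q, Nat.mul_add_div hQ, Nat.div_eq_of_lt hv, add_zero]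
  refine ⟨?_, ?_, ?_⟩
  · rw [coordModulus, ← Nat.div_div_eq_div_mul, h1, mul_comm r Q, Nat.mul_add_div hQ,
      Nat.div_eq_of_lt hu, add_zero]
  · rw [h1, Nat.mul_add_mod_self_right, Nat.mod_eq_of_lt hu]
  · rw [Nat.mul_add_mod_self_right, Nat.mod_eq_of_lt hv]

/-- Entry number `g` of the collection of vectors that belong to the integers in `S`, padded by zero
vectors. -/
def hashEntry (Q : ℕ) (T : ResidueTest) (S : List ℤ) (g : ℕ) : Bool :=
  decide (g / Q ^ 3 < S.length ∧ (coordModulus Q (g % Q ^ 3)).Prime) &&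
    T (coordModulus Q (g % Q ^ 3)) ((g % Q ^ 3 / Q % Q : ℕ) : ℤ) ((g % Q ^ 3 % Q : ℕ) : ℤ)
      (S.getD (g / Q ^ 3) 0)

/-- The vectors that belong to the integers in `S`. -/
def hashVectors (Q N D : ℕ) (T : ResidueTest) (S : List ℤ) : Fin N → Fin D → Bool :=
  fun i j => hashEntry Q T S (i * D + j)

theorem hashVectors_eq_true_iff {Q N D : ℕ} (hD : D = Q ^ 3) (T : ResidueTest) (S : List ℤ)
    (i : Fin N) (c : Fin D) : hashVectors Q N D T S i c = true ↔
      (i : ℕ) < S.length ∧ (coordModulus Q c).Prime ∧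
        T (coordModulus Q c) ((c / Q % Q : ℕ) : ℤ) ((c % Q : ℕ) : ℤ) (S.getD i 0) = true := by
  subst hD
  have h1 : ((i : ℕ) * Q ^ 3 + c) / Q ^ 3 = i := by
    rw [mul_comm, Nat.mul_add_div (by have := c.2; omega), Nat.div_eq_of_lt c.2, add_zero]
  have h2 : ((i : ℕ) * Q ^ 3 + c) % Q ^ 3 = c := by
    rw [Nat.mul_add_mod_self_right, Nat.mod_eq_of_lt c.2]
  simp only [hashVectors, hashEntry, h1, h2, Bool.and_eq_true, decide_eq_true_eq, and_assoc]

theorem tripleInner_eq_card {D : ℕ} (a b c : Fin D → Bool) :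
    tripleInner a b c = (Finset.univ.filter fun j => a j = true ∧ b j = true ∧ c j = true).card := by
  rw [tripleInner, Finset.card_filter]
  refine Finset.sum_congr rfl fun j _ => ?_
  cases a j <;> cases b j <;> cases c j <;> rfl

/-- For a solution `x, y, z` and a prime `q ≤ Q`, the coordinate `(q, x mod q, y mod q)` is a common
one, because `z + x + y ≡ 0`. -/
theorem exists_primeCounting_le_tripleInner {Q N D : ℕ} (hD : D = Q ^ 3) {S₁ S₂ S₃ : List ℤ}
    (h₁ : S₁.length ≤ N) (h₂ : S₂.length ≤ N) (h₃ : S₃.length ≤ N)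
    (h : ∃ x ∈ S₁, ∃ y ∈ S₂, ∃ z ∈ S₃, x + y + z = 0) :
    ∃ i j k, Nat.primeCounting Q ≤ tripleInner (hashVectors Q N D firstTest S₁ i)
      (hashVectors Q N D secondTest S₂ j) (hashVectors Q N D thirdTest S₃ k) := by
  obtain ⟨x, hx, y, hy, z, hz, h⟩ := h
  obtain ⟨i, hi, rfl⟩ := List.getElem_of_mem hx
  obtain ⟨j, hj, rfl⟩ := List.getElem_of_mem hy
  obtain ⟨k, hk, rfl⟩ := List.getElem_of_mem hz
  refine ⟨⟨i, by omega⟩, ⟨j, by omega⟩, ⟨k, by omega⟩, ?_⟩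
  rw [tripleInner_eq_card, Nat.primeCounting, Nat.primeCounting', Nat.count_eq_card_filter_range]
  set x := S₁[i]
  set y := S₂[j]
  set z := S₃[k]
  simp only [hashVectors_eq_true_iff hD, firstTest, secondTest, thirdTest, decide_eq_true_eq,
    List.getD_eq_getElem _ _ hi, List.getD_eq_getElem _ _ hj, List.getD_eq_getElem _ _ hk]
  -- The modulus maps the common ones onto the primes up to `Q`.
  refine Finset.card_le_card_of_surjOn (fun c => coordModulus Q c) ?_
  intro q hq
  simp only [Finset.coe_filter, Finset.mem_range, Set.mem_ofPred_eq] at hq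
  obtain ⟨hqQ, hq⟩ := hq
  have hq2 := hq.two_le
  have hres : ∀ w : ℤ, ∃ r : ℕ, (r : ℤ) = w % q ∧ r < Q := by
    intro w
    have h1 := Int.emod_nonneg w (b := (q : ℤ)) (by omega)
    have h2 := Int.emod_lt_of_pos w (b := (q : ℤ)) (by omega)
    exact ⟨(w % q).toNat, by omega, by omega⟩
  obtain ⟨u, hu, huQ⟩ := hres x
  obtain ⟨v, hv, hvQ⟩ := hres y
  obtain ⟨e1, e2, e3⟩ := coord_decode (r := q - 2) huQ hvQ
  have hlt : ((q - 2) * Q + u) * Q + v < D := by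
    have h1 : (q - 2) * Q + u < Q * Q := by
      have : (q - 2 + 1) * Q ≤ Q * Q := Nat.mul_le_mul_right _ (by omega)
      rw [add_mul] at this
      omega
    have h2 : ((q - 2) * Q + u + 1) * Q ≤ Q * Q * Q := Nat.mul_le_mul_right _ h1
    rw [add_mul] at h2
    rw [hD, show Q ^ 3 = Q * Q * Q by ring]
    omega
  have hmod : coordModulus Q (((q - 2) * Q + u) * Q + v) = q := by omega
  refine ⟨⟨_, hlt⟩, ?_, hmod⟩
  simp only [Finset.coe_filter, Finset.mem_univ, true_and, Set.mem_ofPred_eq, hmod, e2, e3]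
  refine ⟨⟨hi, hq, hu.symm⟩, ⟨hj, hq, hv.symm⟩, ⟨hk, hq, ?_⟩⟩
  rw [hu, hv, add_assoc]
  have : (x + y + z) % q = 0 := by rw [h]; rfl
  rw [← this, add_comm (x + y) z]
  simp only [Int.add_emod, Int.emod_emod]
  rfl

/-- A common one at `(q, u, v)` forces `q ∣ x + y + z`, `u = x mod q` and `v = y mod q`. So each
prime divisor of the nonzero sum contributes at most one coordinate. -/
theorem tripleInner_le_of_forall_ne {Q N D b : ℕ} (hD : D = Q ^ 3) {S₁ S₂ S₃ : List ℤ}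
    (h : ¬ ∃ x ∈ S₁, ∃ y ∈ S₂, ∃ z ∈ S₃, x + y + z = 0)
    (hb : ∀ x ∈ S₁, ∀ y ∈ S₂, ∀ z ∈ S₃, Nat.log 2 (x + y + z).natAbs ≤ b) (i j k : Fin N) :
    tripleInner (hashVectors Q N D firstTest S₁ i)
      (hashVectors Q N D secondTest S₂ j) (hashVectors Q N D thirdTest S₃ k) ≤ b := by
  rw [tripleInner_eq_card]
  -- Vector numbers beyond a list belong to the zero padding and have inner product zero.
  by_cases hlen : (i : ℕ) < S₁.length ∧ (j : ℕ) < S₂.length ∧ (k : ℕ) < S₃.length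
  swap
  · rw [Finset.filter_false_of_mem, Finset.card_empty]
    · exact Nat.zero_le _
    · simp only [hashVectors_eq_true_iff hD]
      tauto
  obtain ⟨hi, hj, hk⟩ := hlen
  have hx : S₁.getD i 0 ∈ S₁ := by simp [hi]
  have hy : S₂.getD j 0 ∈ S₂ := by simp [hj]
  have hz : S₃.getD k 0 ∈ S₃ := by simp [hk]
  have hne : S₁.getD i 0 + S₂.getD j 0 + S₃.getD k 0 ≠ 0 :=
    fun h0 => h ⟨_, hx, _, hy, _, hz, h0⟩
  refine le_trans ?_ ((card_primeFactors_le_log _ (Int.natAbs_ne_zero.2 hne)).trans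
    (hb _ hx _ hy _ hz))
  simp only [hashVectors_eq_true_iff hD, firstTest, secondTest, thirdTest, decide_eq_true_eq]
  set x := S₁.getD i 0
  set y := S₂.getD j 0
  set z := S₃.getD k 0
  refine Finset.card_le_card_of_injOn (fun c => coordModulus Q c) ?_ ?_
  · intro c hc
    simp only [Finset.coe_filter, Finset.mem_univ, true_and, Set.mem_ofPred_eq] at hc
    obtain ⟨⟨-, hp, hu⟩, ⟨-, -, hv⟩, ⟨-, -, hw⟩⟩ := hc
    rw [Finset.mem_coe, Nat.mem_primeFactors]
    refine ⟨hp, ?_, Int.natAbs_ne_zero.2 hne⟩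
    rw [← Int.natCast_dvd]
    apply Int.dvd_of_emod_eq_zero
    rw [← hw, ← hu, ← hv, add_comm (x + y) z, ← add_assoc]
    simp [Int.add_emod]
  · intro c hc c' hc' heq
    simp only [Finset.coe_filter, Finset.mem_univ, true_and, Set.mem_ofPred_eq] at hc hc'
    simp only at heq
    have hu := hc.1.2.2.symm.trans ((congrArg (fun q : ℕ => x % q) heq).trans hc'.1.2.2)
    have hv := hc.2.1.2.2.symm.trans ((congrArg (fun q : ℕ => y % q) heq).trans hc'.2.1.2.2)
    exact Fin.ext (coord_injective heq (by exact_mod_cast hu) (by exact_mod_cast hv))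

namespace RAM

/-! ## Loops of the reduction -/

/-- Sequential composition. -/
infixr:60 " ⨟ " => Prog.seq

/-- For `g` from the value of register 0 up to the number of input cells (three plus register 11),
write the value of `e` to the cell with address `g` minus that number. -/
def shiftLoop (e : Expr) : Prog :=
  .loop (.bin .lt (.reg 0) (.bin .add (.reg 11) (.lit 3)))
    (.write (.bin .sub (.reg 0) (.bin .add (.reg 11) (.lit 3))) e ⨟
      .assign 0 (.bin .add (.reg 0) (.lit 1)))

/-- One lemma serves both for copying the input (`e` reads cell `g`) and for erasing the copy (`e`
is zero). `he` asks for the value of `e` in the partly overwritten memory. -/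
theorem runs_shiftLoop {X U : ℕ} (hX : 2 ≤ X) (hU : 1000 * X.size ≤ U) {e : Expr}
    (hw : e.weight ≤ 100) {F : ℕ → ℤ} {n : ℕ} {a b c d a' b' c' d' a'' b'' : ℤ} {m : ℤ → ℤ}
    (hl : ∀ x ∈ [((n + 3 : ℕ) : ℤ), a, b, c, d, a', b', c', d', a'', b'', n], x.natAbs ≤ X)
    (hm : ∀ x, (m x).natAbs ≤ X) (hF : ∀ g < n + 3, (F g).natAbs ≤ X)
    (he : ∀ g < n + 3, e.val (stateOf [g, a, b, c, d, a', b', c', d', a'', b'', n]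
      (fillMem (-((n + 3 : ℕ) : ℤ)) g F m)) = F g) :
    Runs U (shiftLoop e) (stateOf [0, a, b, c, d, a', b', c', d', a'', b'', n] m)
      (stateOf [((n + 3 : ℕ) : ℤ), a, b, c, d, a', b', c', d', a'', b'', n]
        (fillMem (-((n + 3 : ℕ) : ℤ)) (n + 3) F m)) ((n + 3) * 3 + 1) := by
  simp only [List.forall_mem_cons, List.not_mem_nil, false_imp_iff, implies_true, and_true] at hl
  obtain ⟨hn, hl⟩ := hl
  have hb : ∀ i ≤ n + 3, ∀ j ≤ n + 3,
      (stateOf [(i : ℤ), a, b, c, d, a', b', c', d', a'', b'', n]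
        (fillMem (-((n + 3 : ℕ) : ℤ)) j F m)).Bounded X := by
    intro i hi j hj
    refine bounded_stateOf ?_ (natAbs_fillMem_le (fun _ h => hF _ (by omega)) hm)
    simp only [List.forall_mem_cons, List.not_mem_nil, false_imp_iff, implies_true, and_true]
    exact ⟨by omega, hl⟩
  have key := Runs.loop (U := U) (c := .bin .lt (.reg 0) (.bin .add (.reg 11) (.lit 3)))
    (p := .write (.bin .sub (.reg 0) (.bin .add (.reg 11) (.lit 3))) e ⨟
      .assign 0 (.bin .add (.reg 0) (.lit 1)))
    (fun i => stateOf [(i : ℤ), a, b, c, d, a', b', c', d', a'', b'', n]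
        (fillMem (-((n + 3 : ℕ) : ℤ)) i F m)) (n + 3) 2 ?_ ?_ ?_ ?_
  · simp only [Nat.cast_zero, fillMem_zero] at key
    exact key
  · intro i hi
    refine (Expr.cost_le hX (hb i hi i hi) _).trans (le_trans (Nat.mul_le_mul_right _ ?_) hU)
    decide
  · intro i hi
    simp [Expr.val, stateOf, Op.apply]
    omega
  · simp [Expr.val, stateOf, Op.apply]
  · intro i hi
    refine Runs.seq (j := 1) (k := 1) (Runs.write hX (hb i hi.le i hi.le)
      (le_trans (Nat.mul_le_mul_right _ ?_) hU) ?_) (Runs.assign hX (hb i hi.le (i + 1) hi)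
      (le_trans (Nat.mul_le_mul_right _ ?_) hU) (by simp) ?_)
    · simp only [Expr.weight, Expr.degree]
      omega
    · rw [he i hi, ← update_fillMem]
      congr 1
    · decide
    · simp [Expr.val, stateOf, Op.apply]

/-- The vector number that belongs to register 0. -/
def vecExpr : Expr := .bin .div (.reg 0) (.reg 2)

/-- The coordinate number that belongs to register 0. -/
def coordExpr : Expr := .bin .mod (.reg 0) (.reg 2)

/-- The integer that belongs to the current vector. -/
def itemExpr : Expr := .read (.bin .add (.reg 5) vecExpr)

/-- The first residue of the current coordinate. -/
def firstResidue : Expr := .bin .mod (.bin .div coordExpr (.reg 3)) (.reg 3)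

/-- The second residue of the current coordinate. -/
def secondResidue : Expr := .bin .mod coordExpr (.reg 3)

/-- `firstTest` for the current entry. -/
def firstTestExpr : Expr := .bin .eq (.bin .mod itemExpr (.reg 7)) firstResidue

/-- `secondTest` for the current entry. -/
def secondTestExpr : Expr := .bin .eq (.bin .mod itemExpr (.reg 7)) secondResidue

/-- `thirdTest` for the current entry. -/
def thirdTestExpr : Expr :=
  .bin .eq (.bin .mod (.bin .add (.bin .add itemExpr firstResidue) secondResidue) (.reg 7)) (.lit 0)

/-- Given a modulus in register 7, find its least divisor from register 8 on. -/
def minFacLoop : Prog :=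
  .loop (.bin .mod (.reg 7) (.reg 8)) (.assign 8 (.bin .add (.reg 8) (.lit 1)))

/-- Write the entry number `g` of a collection of vectors, with `g` in register 0. -/
def fillBody (test : Expr) : Prog :=
  .assign 7 (.bin .add (.bin .div coordExpr (.bin .mul (.reg 3) (.reg 3))) (.lit 2)) ⨟
  .assign 8 (.lit 2) ⨟
  minFacLoop ⨟
  .write (.bin .add (.reg 6) (.reg 0)) (.bin .mul (.bin .lt vecExpr (.reg 4))
    (.bin .mul (.bin .eq (.reg 8) (.reg 7)) test)) ⨟
  .assign 7 (.lit 0) ⨟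
  .assign 8 (.lit 0) ⨟
  .assign 0 (.bin .add (.reg 0) (.lit 1))

/-- Write all entries of a collection of vectors. -/
def fillLoop (test : Expr) : Prog :=
  .loop (.bin .lt (.reg 0) (.reg 1)) (fillBody test)

/-- Trial division from 2 stops at `q.minFac ≤ q`, and `q` is prime exactly when it stops at `q`
itself. A linear search is affordable, since moduli are at most `Q + 1 = N ^ o(1)`. -/
theorem runs_minFacLoop {X U : ℕ} (hX : 2 ≤ X) (hU : 1000 * X.size ≤ U) {q : ℕ} (hq : 2 ≤ q)
    {a₀ a₁ a₂ a₃ a₄ a₅ a₆ a₉ a₁₀ a₁₁ : ℤ} {m : ℤ → ℤ}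
    (hl : ∀ x ∈ [a₀, a₁, a₂, a₃, a₄, a₅, a₆, (q : ℤ), a₉, a₁₀, a₁₁], x.natAbs ≤ X)
    (hm : ∀ x, (m x).natAbs ≤ X) :
    Runs U minFacLoop (stateOf [a₀, a₁, a₂, a₃, a₄, a₅, a₆, q, 2, a₉, a₁₀, a₁₁] m)
      (stateOf [a₀, a₁, a₂, a₃, a₄, a₅, a₆, q, q.minFac, a₉, a₁₀, a₁₁] m) (2 * q) := by
  simp only [List.forall_mem_cons, List.not_mem_nil, false_imp_iff, implies_true, and_true] at hl
  have h2 : 2 ≤ q.minFac := (Nat.minFac_prime (by omega)).two_le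
  have hle : q.minFac ≤ q := Nat.minFac_le (by omega)
  have hb : ∀ i ≤ q.minFac - 2,
      (stateOf [a₀, a₁, a₂, a₃, a₄, a₅, a₆, (q : ℤ), ((i + 2 : ℕ) : ℤ), a₉, a₁₀, a₁₁] m).Bounded
        X := by
    intro i hi
    refine bounded_stateOf ?_ hm
    simp only [List.forall_mem_cons, List.not_mem_nil, false_imp_iff, implies_true, and_true]
    refine ⟨hl.1, hl.2.1, hl.2.2.1, hl.2.2.2.1, hl.2.2.2.2.1, hl.2.2.2.2.2.1, hl.2.2.2.2.2.2.1,
      hl.2.2.2.2.2.2.2.1, ?_, hl.2.2.2.2.2.2.2.2⟩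
    have := hl.2.2.2.2.2.2.2.1
    omega
  have key := Runs.loop (U := U) (c := .bin .mod (.reg 7) (.reg 8))
    (p := .assign 8 (.bin .add (.reg 8) (.lit 1)))
    (fun i => stateOf [a₀, a₁, a₂, a₃, a₄, a₅, a₆, (q : ℤ), ((i + 2 : ℕ) : ℤ), a₉, a₁₀, a₁₁] m)
    (q.minFac - 2) 1 ?_ ?_ ?_ ?_
  · simp only [Nat.sub_add_cancel h2, zero_add, Nat.cast_ofNat] at key
    exact key.mono (by omega)
  · intro i hi
    refine (Expr.cost_le hX (hb i hi) _).trans (le_trans (Nat.mul_le_mul_right _ ?_) hU)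
    decide
  · intro i hi h0
    have hdvd : i + 2 ∣ q := by
      simp only [Expr.val, stateOf, Op.apply] at h0
      exact Int.natCast_dvd_natCast.1 (Int.dvd_of_emod_eq_zero h0)
    have := Nat.minFac_le_of_dvd (by omega) hdvd
    omega
  · simp only [Expr.val, stateOf, Op.apply, Nat.sub_add_cancel h2]
    exact Int.emod_eq_zero_of_dvd (Int.natCast_dvd_natCast.2 q.minFac_dvd)
  · intro i hi
    refine Runs.assign hX (hb i hi.le) (le_trans (Nat.mul_le_mul_right _ ?_) hU) (by simp) ?_
    · decide
    · simp [Expr.val, stateOf, Op.apply]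
      ring

/-- The expression `test` computes `T` for the current entry. -/
def Computes (test : Expr) (T : ResidueTest) : Prop :=
  ∀ (g D Q q : ℕ) (a₁ a₄ off a₆ a₈ a₉ a₁₀ a₁₁ : ℤ) (m : ℤ → ℤ),
    test.val (stateOf [(g : ℤ), a₁, (D : ℤ), (Q : ℤ), a₄, off, a₆, (q : ℤ), a₈, a₉, a₁₀, a₁₁] m) =
      (T q ((g % D / Q % Q : ℕ) : ℤ) ((g % D % Q : ℕ) : ℤ) (m (off + (g / D : ℕ)))).toNat

theorem computes_firstTestExpr : Computes firstTestExpr firstTest := by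
  intro g D Q q a₁ a₄ off a₆ a₈ a₉ a₁₀ a₁₁ m
  simp only [firstTestExpr, itemExpr, vecExpr, firstResidue, coordExpr, Expr.val, Op.apply, stateOf,
    firstTest, List.getD_cons_zero, List.getD_cons_succ]
  push_cast
  split_ifs with h <;> simp [h]

theorem computes_secondTestExpr : Computes secondTestExpr secondTest := by
  intro g D Q q a₁ a₄ off a₆ a₈ a₉ a₁₀ a₁₁ m
  simp only [secondTestExpr, itemExpr, vecExpr, secondResidue, coordExpr, Expr.val, Op.apply,
    stateOf, secondTest, List.getD_cons_zero, List.getD_cons_succ]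
  push_cast
  split_ifs with h <;> simp [h]

theorem computes_thirdTestExpr : Computes thirdTestExpr thirdTest := by
  intro g D Q q a₁ a₄ off a₆ a₈ a₉ a₁₀ a₁₁ m
  simp only [thirdTestExpr, itemExpr, vecExpr, firstResidue, secondResidue, coordExpr, Expr.val,
    Op.apply, stateOf, thirdTest, List.getD_cons_zero, List.getD_cons_succ]
  push_cast
  split_ifs with h <;> simp [h]

theorem coordModulus_le {Q c : ℕ} (hQ : 1 ≤ Q) (hc : c < Q ^ 3) : coordModulus Q c ≤ Q + 1 := by
  have : c / (Q * Q) < Q := by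
    rw [Nat.div_lt_iff_lt_mul (by positivity)]
    calc c < Q ^ 3 := hc
      _ = Q * (Q * Q) := by ring
  rw [coordModulus]
  omega

/-- The source list lies below the destination (`hoff`), so it can still be read while entries are
being written. Registers 7 and 8 are reset in each round, so that the state between rounds depends
on `g` only. Trial division dominates the cost `2 * Q + 9` per entry. -/
theorem runs_fillLoop {X U : ℕ} (hX : 2 ≤ X) (hU : 1000 * X.size ≤ U) {test : Expr}
    (hw : test.weight ≤ 200 ∧ test.degree ≤ 100) {T : ResidueTest} (hT : Computes test T)
    {G D Q : ℕ} (hQ : 1 ≤ Q) (hD : D = Q ^ 3) {S : List ℤ} {off dst a₉ a₁₀ a₁₁ : ℤ} {m : ℤ → ℤ}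
    (hl : ∀ x ∈ [(G : ℤ), (D : ℤ), ((Q + 1 : ℕ) : ℤ), (S.length : ℤ), off, dst, a₉, a₁₀, a₁₁],
      x.natAbs ≤ X)
    (hm : ∀ x, (m x).natAbs ≤ X) (hS : ∀ i < S.length, m (off + i) = S.getD i 0)
    (hoff : off + S.length ≤ dst) :
    Runs U (fillLoop test) (stateOf [0, G, D, Q, S.length, off, dst, 0, 0, a₉, a₁₀, a₁₁] m)
      (stateOf [G, G, D, Q, S.length, off, dst, 0, 0, a₉, a₁₀, a₁₁]
        (fillMem dst G (fun g => (hashEntry Q T S g).toNat) m)) (G * (2 * Q + 9) + 1) := by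
  simp only [List.forall_mem_cons, List.not_mem_nil, false_imp_iff, implies_true, and_true] at hl
  obtain ⟨hG, hDX, hQX, hSX, hoffX, hdst, h9, h10, h11⟩ := hl
  set F : ℕ → ℤ := fun g => (hashEntry Q T S g).toNat with hFdef
  have hF : ∀ g, (F g).natAbs ≤ X := by
    intro g
    have : ∀ b : Bool, b.toNat ≤ 1 := by decide
    have := this (hashEntry Q T S g)
    simp only [hFdef, Int.natAbs_natCast]
    omega
  have hlist : ∀ g ≤ G, ∀ q ≤ Q + 1, ∀ t ≤ Q + 1, ∀ x ∈ [(g : ℤ), (G : ℤ), (D : ℤ), (Q : ℤ),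
      (S.length : ℤ), off, dst, (q : ℤ), (t : ℤ), a₉, a₁₀, a₁₁], x.natAbs ≤ X := by
    intro g hg q hq t ht
    simp only [List.forall_mem_cons, List.not_mem_nil, false_imp_iff, implies_true, and_true]
    refine ⟨by omega, hG, hDX, by omega, hSX, hoffX, hdst, by omega, by omega, h9, h10, h11⟩
  have hb : ∀ g ≤ G, ∀ q ≤ Q + 1, ∀ t ≤ Q + 1, ∀ j,
      (stateOf [(g : ℤ), (G : ℤ), (D : ℤ), (Q : ℤ),
      (S.length : ℤ), off, dst, (q : ℤ), (t : ℤ), a₉, a₁₀, a₁₁] (fillMem dst j F m)).Bounded X :=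
    fun g hg q hq t ht j => bounded_stateOf (hlist g hg q hq t ht)
      (natAbs_fillMem_le (fun _ _ => hF _) hm)
  have key := Runs.loop (U := U) (c := .bin .lt (.reg 0) (.reg 1)) (p := fillBody test)
    (fun g => stateOf [(g : ℤ), (G : ℤ), (D : ℤ), (Q : ℤ),
      (S.length : ℤ), off, dst, ((0 : ℕ) : ℤ), ((0 : ℕ) : ℤ), a₉, a₁₀, a₁₁] (fillMem dst g F m))
    G (2 * Q + 8) ?_ ?_ ?_ ?_
  · simp only [Nat.cast_zero, fillMem_zero] at key
    exact key
  · intro i hi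
    refine (Expr.cost_le hX (hb i hi 0 (by omega) 0 (by omega) i) _).trans
      (le_trans (Nat.mul_le_mul_right _ ?_) hU)
    decide
  · intro i hi
    simp [Expr.val, stateOf, Op.apply]
    omega
  · simp [Expr.val, stateOf, Op.apply]
  · intro g hg
    have hD0 : 0 < D := by rw [hD]; positivity
    set q := coordModulus Q (g % D) with hq
    have hqQ : q ≤ Q + 1 := coordModulus_le hQ (by rw [← hD]; exact Nat.mod_lt _ hD0)
    have hq2 : 2 ≤ q := Nat.le_add_left 2 _
    have hmin : q.minFac ≤ q := Nat.minFac_le (by omega)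
    have s1 : Runs U (.assign 7
        (.bin .add (.bin .div coordExpr (.bin .mul (.reg 3) (.reg 3))) (.lit 2))) _ _ 1 :=
      Runs.assign (l' := [(g : ℤ), (G : ℤ), (D : ℤ), (Q : ℤ), (S.length : ℤ), off, dst, (q : ℤ),
        ((0 : ℕ) : ℤ), a₉, a₁₀, a₁₁]) hX (hb g hg.le 0 (by omega) 0 (by omega) g)
        (le_trans (Nat.mul_le_mul_right _ (by decide)) hU) (by simp)
        (by simp [Expr.val, stateOf, Op.apply, coordExpr, hq, coordModulus])
    have s2 : Runs U (.assign 8 (.lit 2)) _ _ 1 :=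
      Runs.assign (l' := [(g : ℤ), (G : ℤ), (D : ℤ), (Q : ℤ), (S.length : ℤ), off, dst, (q : ℤ),
        2, a₉, a₁₀, a₁₁]) hX (hb g hg.le q hqQ 0 (by omega) g)
        (le_trans (Nat.mul_le_mul_right _ (by decide)) hU) (by simp)
        (by simp [Expr.val])
    have s3 : Runs U minFacLoop (stateOf [(g : ℤ), (G : ℤ), (D : ℤ), (Q : ℤ), (S.length : ℤ), off,
        dst, (q : ℤ), 2, a₉, a₁₀, a₁₁] (fillMem dst g F m)) _ (2 * q) :=
      runs_minFacLoop hX hU hq2 (by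
        have := hlist g hg.le q hqQ 0 (by omega)
        simp only [List.forall_mem_cons] at this ⊢
        tauto) (natAbs_fillMem_le (fun _ _ => hF _) hm)
    have s4 : Runs U (.write (.bin .add (.reg 6) (.reg 0)) (.bin .mul (.bin .lt vecExpr (.reg 4))
        (.bin .mul (.bin .eq (.reg 8) (.reg 7)) test))) _ _ 1 :=
      Runs.write (m' := fillMem dst (g + 1) F m) hX (hb g hg.le q hqQ q.minFac (by omega) g)
        (le_trans (Nat.mul_le_mul_right _ (by
          simp only [Expr.weight, Expr.degree, vecExpr]
          omega)) hU) (by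
        rw [← update_fillMem]
        congr 1
        simp only [Expr.val, hT g D Q q]
        simp only [vecExpr, Expr.val, Op.apply, stateOf, List.getD_cons_zero, List.getD_cons_succ]
        -- The comparison of registers 8 and 7 is the primality test.
        have hpr : ((q.minFac : ℤ) = q) ↔ q.Prime := by
          rw [Nat.prime_def_minFac, Nat.cast_inj]
          tauto
        have hdiv : ((g : ℤ) / D) = ((g / D : ℕ) : ℤ) := by push_cast; rfl
        have hentry : hashEntry Q T S g = (decide (g / D < S.length ∧ q.Prime) &&
            T q ((g % D / Q % Q : ℕ) : ℤ) ((g % D % Q : ℕ) : ℤ) (S.getD (g / D) 0)) := by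
          rw [hashEntry, ← hD]
        simp only [hdiv, hpr, hFdef, hentry, Nat.cast_lt]
        by_cases hlt : g / D < S.length
        · have hmem : fillMem dst g F m (off + ((g / D : ℕ) : ℤ)) = S.getD (g / D) 0 := by
            rw [fillMem, if_neg (by omega), hS _ hlt]
          rw [hmem]
          by_cases hp : q.Prime <;> simp [hlt, hp]
        · simp [hlt])
    have s5 : Runs U (.assign 7 (.lit 0)) _ _ 1 :=
      Runs.assign (l' := [(g : ℤ), (G : ℤ), (D : ℤ), (Q : ℤ), (S.length : ℤ), off, dst,
        ((0 : ℕ) : ℤ), (q.minFac : ℤ), a₉, a₁₀, a₁₁]) hX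
        (hb g hg.le q hqQ q.minFac (by omega) (g + 1))
        (le_trans (Nat.mul_le_mul_right _ (by decide)) hU) (by simp) (by simp [Expr.val])
    have s6 : Runs U (.assign 8 (.lit 0)) _ _ 1 :=
      Runs.assign (l' := [(g : ℤ), (G : ℤ), (D : ℤ), (Q : ℤ), (S.length : ℤ), off, dst,
        ((0 : ℕ) : ℤ), ((0 : ℕ) : ℤ), a₉, a₁₀, a₁₁]) hX
        (hb g hg.le 0 (by omega) q.minFac (by omega) (g + 1))
        (le_trans (Nat.mul_le_mul_right _ (by decide)) hU) (by simp) (by simp [Expr.val])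
    have s7 : Runs U (.assign 0 (.bin .add (.reg 0) (.lit 1))) _ _ 1 :=
      Runs.assign (l' := [((g + 1 : ℕ) : ℤ), (G : ℤ), (D : ℤ), (Q : ℤ), (S.length : ℤ), off, dst,
        ((0 : ℕ) : ℤ), ((0 : ℕ) : ℤ), a₉, a₁₀, a₁₁]) hX
        (hb g hg.le 0 (by omega) 0 (by omega) (g + 1))
        (le_trans (Nat.mul_le_mul_right _ (by decide)) hU) (by simp)
        (by simp [Expr.val, stateOf, Op.apply])
    exact (s1.seq (s2.seq (s3.seq (s4.seq (s5.seq (s6.seq s7)))))).mono (by omega)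

end RAM

/-! ### Executions with tracked value bounds -/

namespace RAM

/-- All of the integers in `l` and the memory cells have absolute value at most `X`. -/
def BoundedBy (X : ℕ) (l : List ℤ) (m : ℤ → ℤ) : Prop :=
  (∀ x ∈ l, x.natAbs ≤ X) ∧ ∀ a, (m a).natAbs ≤ X

theorem BoundedBy.bounded {X : ℕ} {l : List ℤ} {m : ℤ → ℤ} (h : BoundedBy X l m) :
    (stateOf l m).Bounded X := bounded_stateOf h.1 h.2

theorem BoundedBy.assign {X U : ℕ} {l : List ℤ} {m : ℤ → ℤ} (h : BoundedBy X l m) (hX : 2 ≤ X)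
    (hU : 1000 * X.size ≤ U) (i : ℕ) (e : Expr) (v : ℤ) (hi : i < l.length)
    (he : e.weight ≤ 1000) (hv : e.val (stateOf l m) = v) (hvX : v.natAbs ≤ X) :
    Runs U (.assign i e) (stateOf l m) (stateOf (l.set i v) m) 1 ∧ BoundedBy X (l.set i v) m := by
  refine ⟨Runs.assign hX h.bounded ((Nat.mul_le_mul_right _ he).trans hU) hi (by rw [hv]),
    fun x hx => ?_, h.2⟩
  rcases List.mem_or_eq_of_mem_set hx with hx | rfl
  · exact h.1 x hx
  · exact hvX

/-- `Expr.weight` charges a literal its absolute value, which is useless for `2 ^ L₀`; here the bit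
length itself is compared with that of `X`. -/
theorem BoundedBy.assign_lit {X U : ℕ} {l : List ℤ} {m : ℤ → ℤ} (h : BoundedBy X l m) (hX : 2 ≤ X)
    (hU : 1000 * X.size ≤ U) (i : ℕ) (v : ℤ) (hi : i < l.length) (hvX : v.natAbs ≤ X) :
    Runs U (.assign i (.lit v)) (stateOf l m) (stateOf (l.set i v) m) 1 ∧
      BoundedBy X (l.set i v) m := by
  refine ⟨Runs.assign_of_cost ?_ hi rfl, fun x hx => ?_, h.2⟩
  · have h1 : bitLength v ≤ X.size := Nat.size_le_size hvX
    have h2 : 1 ≤ X.size := Nat.size_pos.2 (by omega)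
    simp only [Expr.cost]
    omega
  · rcases List.mem_or_eq_of_mem_set hx with hx | rfl
    · exact h.1 x hx
    · exact hvX

theorem BoundedBy.write {X U : ℕ} {l : List ℤ} {m : ℤ → ℤ} (h : BoundedBy X l m) (hX : 2 ≤ X)
    (hU : 1000 * X.size ≤ U) (a e : Expr) (d v : ℤ) (he : a.weight + e.weight ≤ 1000)
    (hd : a.val (stateOf l m) = d) (hv : e.val (stateOf l m) = v) (hvX : v.natAbs ≤ X) :
    Runs U (.write a e) (stateOf l m) (stateOf l (Function.update m d v)) 1 ∧
      BoundedBy X l (Function.update m d v) := by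
  refine ⟨Runs.write hX h.bounded ((Nat.mul_le_mul_right _ he).trans hU) (by rw [hd, hv]), h.1,
    fun x => ?_⟩
  rcases eq_or_ne x d with rfl | hx
  · simpa using hvX
  · simpa [Function.update_of_ne hx] using h.2 x

/-- A loop whose body runs from one list of registers to the next, leaving the memory alone. -/
theorem runs_registerLoop {X U : ℕ} (hX : 2 ≤ X) (hU : 1000 * X.size ≤ U) {c : Expr} {p : Prog}
    {m : ℤ → ℤ} (S : ℕ → List ℤ) (j b : ℕ) (hw : c.weight ≤ 1000)
    (hb : ∀ i ≤ j, BoundedBy X (S i) m)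
    (hv : ∀ i < j, c.val (stateOf (S i) m) ≠ 0) (h0 : c.val (stateOf (S j) m) = 0)
    (hp : ∀ i < j, Runs U p (stateOf (S i) m) (stateOf (S (i + 1)) m) b) :
    Runs U (.loop c p) (stateOf (S 0) m) (stateOf (S j) m) (j * (b + 1) + 1) :=
  Runs.loop (fun i => stateOf (S i) m) j b (fun i hi => (c.cost_le hX (hb i hi).bounded).trans
    ((Nat.mul_le_mul_right _ hw).trans hU)) hv h0 hp

/-! ## Parameters -/

/-- The exponent `l` such that a collection of `2 ^ L` integers is hashed modulo the primes up to
`4 ^ l`. -/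
def hashExponent (L : ℕ) : ℕ := L / Nat.log 2 L

/-- Double register 9 and increment register 10 until register 9 is at least register 11. -/
def doubleLoop : Prog :=
  .loop (.bin .lt (.reg 9) (.reg 11)) (.assign 9 (.bin .mul (.reg 9) (.lit 2)) ⨟
    .assign 10 (.bin .add (.reg 10) (.lit 1)))

/-- Compute in register 7 the integer logarithm of register 10. -/
def logLoop : Prog :=
  .loop (.bin .lt (.bin .mul (.reg 8) (.lit 2)) (.bin .add (.reg 10) (.lit 1)))
    (.assign 8 (.bin .mul (.reg 8) (.lit 2)) ⨟ .assign 7 (.bin .add (.reg 7) (.lit 1)))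

/-- Compute in registers 3 and 6 the powers of 4 and 2 with exponent in register 4. -/
def powerLoop : Prog :=
  .loop (.bin .lt (.reg 8) (.reg 4)) (.assign 3 (.bin .mul (.reg 3) (.lit 4)) ⨟
    .assign 6 (.bin .mul (.reg 6) (.lit 2)) ⨟ .assign 8 (.bin .add (.reg 8) (.lit 1)))

theorem runs_doubleLoop {X U : ℕ} (hX : 2 ≤ X) (hU : 1000 * X.size ≤ U) {n L₀ L : ℕ}
    (hL : L = max L₀ (Nat.clog 2 n)) (hLX : L ≤ X) (hNX : 2 ^ L ≤ X) {a : ℤ} {m : ℤ → ℤ}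
    (hb : BoundedBy X [a, 0, 0, 0, 0, 0, 0, 0, 0, 0, 0, (n : ℤ)] m) :
    Runs U doubleLoop
      (stateOf [a, 0, 0, 0, 0, 0, 0, 0, 0, ((2 ^ L₀ : ℕ) : ℤ), (L₀ : ℤ), (n : ℤ)] m)
      (stateOf [a, 0, 0, 0, 0, 0, 0, 0, 0, ((2 ^ L : ℕ) : ℤ), (L : ℤ), (n : ℤ)] m)
      ((L - L₀) * 3 + 1) := by
  have hL0 : L₀ + (L - L₀) = L := by omega
  have hb' : ∀ i ≤ L, BoundedBy X
      [a, 0, 0, 0, 0, 0, 0, 0, 0, ((2 ^ i : ℕ) : ℤ), (i : ℤ), (n : ℤ)] m := by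
    intro i hi
    refine ⟨?_, hb.2⟩
    have h1 := hb.1
    have h2 : 2 ^ i ≤ 2 ^ L := Nat.pow_le_pow_right (by norm_num) hi
    simp only [List.forall_mem_cons, List.not_mem_nil, false_imp_iff, implies_true, and_true,
      Int.natAbs_natCast] at h1 ⊢
    have := h2.trans hNX
    have := hi.trans hLX
    tauto
  have key := runs_registerLoop (m := m) hX hU (c := .bin .lt (.reg 9) (.reg 11))
    (p := .assign 9 (.bin .mul (.reg 9) (.lit 2)) ⨟ .assign 10 (.bin .add (.reg 10) (.lit 1)))
    (fun i => [a, 0, 0, 0, 0, 0, 0, 0, 0, ((2 ^ (L₀ + i) : ℕ) : ℤ), ((L₀ + i : ℕ) : ℤ), (n : ℤ)])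
    (L - L₀) 2 (by decide) (fun i hi => hb' _ (by omega)) ?_ ?_ ?_
  · simp only [hL0, add_zero] at key
    exact key
  · intro i hi
    have : 2 ^ (L₀ + i) < n := by
      rw [← Nat.lt_clog_iff_pow_lt (by norm_num)]
      omega
    have : ((2 ^ (L₀ + i) : ℕ) : ℤ) < n := by exact_mod_cast this
    simp only [Expr.val, Op.apply, stateOf, List.getD_cons_zero, List.getD_cons_succ, this]
    simp
  · have : n ≤ 2 ^ L := by
      rw [← Nat.clog_le_iff_le_pow (by norm_num)]
      omega
    have : ¬ ((2 ^ L : ℕ) : ℤ) < n := by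
      rw [not_lt]
      exact_mod_cast this
    simp only [hL0, Expr.val, Op.apply, stateOf, List.getD_cons_zero, List.getD_cons_succ, this]
    simp
  · intro i hi
    have hp := hb' (L₀ + i + 1) (by omega)
    obtain ⟨s1, b1⟩ := (hb' (L₀ + i) (by omega)).assign hX hU 9 (.bin .mul (.reg 9) (.lit 2))
      ((2 ^ (L₀ + i + 1) : ℕ) : ℤ) (by simp) (by decide)
      (by simp [Expr.val, Op.apply, stateOf, pow_succ]) (hp.1 _ (by simp))
    obtain ⟨s2, -⟩ := b1.assign hX hU 10 (.bin .add (.reg 10) (.lit 1)) ((L₀ + i + 1 : ℕ) : ℤ)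
      (by simp) (by decide) (by simp [Expr.val, Op.apply, stateOf]) (hp.1 _ (by simp))
    exact s1.seq s2

theorem runs_logLoop {X U : ℕ} (hX : 2 ≤ X) (hU : 1000 * X.size ≤ U) {L : ℕ} (hL : 1 ≤ L)
    {a N n : ℤ} {m : ℤ → ℤ} (hb : BoundedBy X [a, 0, 0, 0, 0, 0, 0, 0, 0, N, (L : ℤ), n] m) :
    Runs U logLoop (stateOf [a, 0, 0, 0, 0, 0, 0, 0, 1, N, (L : ℤ), n] m)
      (stateOf [a, 0, 0, 0, 0, 0, 0, (Nat.log 2 L : ℤ), ((2 ^ Nat.log 2 L : ℕ) : ℤ), N, L, n] m)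
      (Nat.log 2 L * 3 + 1) := by
  have hb' : ∀ i ≤ Nat.log 2 L, BoundedBy X
      [a, 0, 0, 0, 0, 0, 0, (i : ℤ), ((2 ^ i : ℕ) : ℤ), N, (L : ℤ), n] m := by
    intro i hi
    refine ⟨?_, hb.2⟩
    have h1 := hb.1
    have h2 : 2 ^ i ≤ L := Nat.pow_le_of_le_log (by omega) hi
    have h3 : i < 2 ^ i := Nat.lt_two_pow_self
    simp only [List.forall_mem_cons, List.not_mem_nil, false_imp_iff, implies_true, and_true,
      Int.natAbs_natCast] at h1 ⊢
    have h4 : 2 ^ i ≤ X := by omega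
    have h5 : i ≤ X := by omega
    tauto
  have key := runs_registerLoop (m := m) hX hU
    (c := .bin .lt (.bin .mul (.reg 8) (.lit 2)) (.bin .add (.reg 10) (.lit 1)))
    (p := .assign 8 (.bin .mul (.reg 8) (.lit 2)) ⨟ .assign 7 (.bin .add (.reg 7) (.lit 1)))
    (fun i => [a, 0, 0, 0, 0, 0, 0, (i : ℤ), ((2 ^ i : ℕ) : ℤ), N, (L : ℤ), n])
    (Nat.log 2 L) 2 (by decide) hb' ?_ ?_ ?_
  · exact key
  · intro i hi
    -- The guard tests `2 ^ (i + 1) < L + 1`, that is, a non-strict comparison with `L`.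
    have : 2 ^ (i + 1) ≤ L := Nat.pow_le_of_le_log (by omega) hi
    have : ((2 ^ i : ℕ) : ℤ) * 2 < (L : ℤ) + 1 := by
      rw [pow_succ] at this
      omega
    simp only [Expr.val, Op.apply, stateOf, List.getD_cons_zero, List.getD_cons_succ, this]
    simp
  · have : L < 2 ^ (Nat.log 2 L + 1) := Nat.lt_pow_succ_log_self (by norm_num) L
    have : ¬ ((2 ^ Nat.log 2 L : ℕ) : ℤ) * 2 < (L : ℤ) + 1 := by
      rw [pow_succ] at this
      omega
    simp only [Expr.val, Op.apply, stateOf, List.getD_cons_zero, List.getD_cons_succ, this]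
    simp
  · intro i hi
    have hp := hb' (i + 1) hi
    obtain ⟨s1, b1⟩ := (hb' i hi.le).assign hX hU 8 (.bin .mul (.reg 8) (.lit 2))
      ((2 ^ (i + 1) : ℕ) : ℤ) (by simp) (by decide)
      (by simp [Expr.val, Op.apply, stateOf, pow_succ]) (hp.1 _ (by simp))
    obtain ⟨s2, -⟩ := b1.assign hX hU 7 (.bin .add (.reg 7) (.lit 1)) ((i + 1 : ℕ) : ℤ)
      (by simp) (by decide) (by simp [Expr.val, Op.apply, stateOf]) (hp.1 _ (by simp))
    exact s1.seq s2

theorem runs_powerLoop {X U : ℕ} (hX : 2 ≤ X) (hU : 1000 * X.size ≤ U) {l : ℕ} (hl : 4 ^ l ≤ X)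
    {a k N L n : ℤ} {m : ℤ → ℤ} (hb : BoundedBy X [a, 0, 0, 1, (l : ℤ), 0, 1, k, 0, N, L, n] m) :
    Runs U powerLoop (stateOf [a, 0, 0, 1, (l : ℤ), 0, 1, k, 0, N, L, n] m)
      (stateOf [a, 0, 0, ((4 ^ l : ℕ) : ℤ), (l : ℤ), 0, ((2 ^ l : ℕ) : ℤ), k, l, N, L, n] m)
      (l * 4 + 1) := by
  have hb' : ∀ i ≤ l, BoundedBy X
      [a, 0, 0, ((4 ^ i : ℕ) : ℤ), (l : ℤ), 0, ((2 ^ i : ℕ) : ℤ), k, (i : ℤ), N, L, n] m := by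
    intro i hi
    refine ⟨?_, hb.2⟩
    have h1 := hb.1
    have h2 : 4 ^ i ≤ 4 ^ l := Nat.pow_le_pow_right (by norm_num) hi
    have h3 : i < 2 ^ i := Nat.lt_two_pow_self
    have h4 : 2 ^ i ≤ 4 ^ i := Nat.pow_le_pow_left (by norm_num) i
    simp only [List.forall_mem_cons, List.not_mem_nil, false_imp_iff, implies_true, and_true,
      Int.natAbs_natCast] at h1 ⊢
    have h5 : 2 ^ i ≤ X := by omega
    have h6 : i ≤ X := by omega
    have h7 : 4 ^ i ≤ X := by omega
    tauto
  have key := runs_registerLoop (m := m) hX hU (c := .bin .lt (.reg 8) (.reg 4))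
    (p := .assign 3 (.bin .mul (.reg 3) (.lit 4)) ⨟
      .assign 6 (.bin .mul (.reg 6) (.lit 2)) ⨟ .assign 8 (.bin .add (.reg 8) (.lit 1)))
    (fun i => [a, 0, 0, ((4 ^ i : ℕ) : ℤ), (l : ℤ), 0, ((2 ^ i : ℕ) : ℤ), k, (i : ℤ), N, L, n])
    l 3 (by decide) hb' ?_ ?_ ?_
  · exact key
  · intro i hi
    simp [Expr.val, Op.apply, stateOf, hi]
  · simp [Expr.val, Op.apply, stateOf]
  · intro i hi
    have hp := hb' (i + 1) hi
    obtain ⟨s1, b1⟩ := (hb' i hi.le).assign hX hU 3 (.bin .mul (.reg 3) (.lit 4))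
      ((4 ^ (i + 1) : ℕ) : ℤ) (by simp) (by decide)
      (by simp [Expr.val, Op.apply, stateOf, pow_succ]) (hp.1 _ (by simp))
    obtain ⟨s2, b2⟩ := b1.assign hX hU 6 (.bin .mul (.reg 6) (.lit 2))
      ((2 ^ (i + 1) : ℕ) : ℤ) (by simp) (by decide)
      (by simp [Expr.val, Op.apply, stateOf, pow_succ]) (hp.1 _ (by simp))
    obtain ⟨s3, -⟩ := b2.assign hX hU 8 (.bin .add (.reg 8) (.lit 1)) ((i + 1 : ℕ) : ℤ)
      (by simp) (by decide) (by simp [Expr.val, Op.apply, stateOf]) (hp.1 _ (by simp))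
    exact s1.seq (s2.seq s3)

end RAM

namespace RAM

/-! ## The reduction -/

/-- Make a copy of the input at negative addresses. -/
def copyInput : Prog :=
  .assign 11 (.bin .add (.bin .add (.read (.lit 0)) (.read (.lit 1))) (.read (.lit 2))) ⨟
  shiftLoop (.read (.reg 0))

/-- Compute the parameters of the target instance and write them. -/
def computeParams (L₀ : ℕ) : Prog :=
  .assign 9 (.lit (2 ^ L₀ : ℕ)) ⨟ .assign 10 (.lit L₀) ⨟ doubleLoop ⨟
  .assign 8 (.lit 1) ⨟ logLoop ⨟ .assign 4 (.bin .div (.reg 10) (.reg 7)) ⨟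
  .assign 8 (.lit 0) ⨟ .assign 3 (.lit 1) ⨟ .assign 6 (.lit 1) ⨟ powerLoop ⨟
  .write (.lit 0) (.reg 9) ⨟
  .assign 2 (.bin .mul (.bin .mul (.reg 3) (.reg 3)) (.reg 3)) ⨟
  .write (.lit 1) (.reg 2) ⨟ .write (.lit 2) (.reg 6) ⨟
  .assign 1 (.bin .mul (.reg 9) (.reg 2)) ⨟ .assign 7 (.lit 0) ⨟ .assign 8 (.lit 0)

/-- Write the collection of vectors of the next list of integers, whose length was in input
cell `i`. -/
def writeCollection (i : ℤ) (test : Expr) : Prog :=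
  .assign 0 (.lit 0) ⨟ .assign 5 (.bin .add (.reg 5) (.reg 4)) ⨟
  .assign 4 (.read (.bin .sub (.lit i) (.bin .add (.reg 11) (.lit 3)))) ⨟
  .assign 6 (.bin .add (.reg 6) (.reg 1)) ⨟ fillLoop test

/-- Write the three collections of vectors. -/
def writeCollections : Prog :=
  .assign 4 (.lit 0) ⨟ .assign 5 (.bin .sub (.lit 0) (.reg 11)) ⨟
  .assign 6 (.bin .sub (.lit 3) (.reg 1)) ⨟ writeCollection 0 firstTestExpr ⨟
  writeCollection 1 secondTestExpr ⨟ writeCollection 2 thirdTestExpr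

/-- Erase the copy of the input and the registers. -/
def cleanUp : Prog :=
  .assign 0 (.lit 0) ⨟ shiftLoop (.lit 0) ⨟
  .assign 0 (.lit 0) ⨟ .assign 1 (.lit 0) ⨟ .assign 2 (.lit 0) ⨟ .assign 3 (.lit 0) ⨟
  .assign 4 (.lit 0) ⨟ .assign 5 (.lit 0) ⨟ .assign 6 (.lit 0) ⨟ .assign 9 (.lit 0) ⨟
  .assign 10 (.lit 0) ⨟ .assign 11 (.lit 0)

/-- Replace a 3-SUM instance by an instance of trichromatic maximum inner product with
`2 ^ max L₀ (Nat.clog 2 n)` vectors. -/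
def reduction (L₀ : ℕ) : Prog :=
  copyInput ⨟ computeParams L₀ ⨟ writeCollections ⨟ cleanUp

theorem runs_copyInput {X U : ℕ} (hX : 2 ≤ X) (hU : 1000 * X.size ≤ U) {n : ℕ} (hn : n + 3 ≤ X)
    {m : ℤ → ℤ} (hb : BoundedBy X [0, 0, 0, 0, 0, 0, 0, 0, 0, 0, 0, 0] m)
    (hm : m 0 + m 1 + m 2 = n) :
    let m' := fillMem (-((n + 3 : ℕ) : ℤ)) (n + 3) (fun i => m i) m
    Runs U copyInput (stateOf [0, 0, 0, 0, 0, 0, 0, 0, 0, 0, 0, 0] m)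
      (stateOf [((n + 3 : ℕ) : ℤ), 0, 0, 0, 0, 0, 0, 0, 0, 0, 0, n] m') ((n + 3) * 3 + 2) ∧
    BoundedBy X [((n + 3 : ℕ) : ℤ), 0, 0, 0, 0, 0, 0, 0, 0, 0, 0, n] m' := by
  intro m'
  obtain ⟨s1, b1⟩ := hb.assign hX hU 11
    (.bin .add (.bin .add (.read (.lit 0)) (.read (.lit 1))) (.read (.lit 2))) n
    (by simp) (by decide) (by simpa [Expr.val, Op.apply, stateOf] using hm) (by omega)
  have hl : ∀ x ∈ [((n + 3 : ℕ) : ℤ), 0, 0, 0, 0, 0, 0, 0, 0, 0, 0, (n : ℤ)], x.natAbs ≤ X := by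
    simp only [List.forall_mem_cons, List.not_mem_nil, false_imp_iff, implies_true, and_true,
      Int.natAbs_natCast]
    simp
    omega
  have s2 := runs_shiftLoop hX hU (e := .read (.reg 0)) (by decide) (F := fun i => m i) hl hb.2
    (fun g _ => hb.2 _) (fun g hg => by
      simp only [Expr.val, stateOf, List.getD_cons_zero]
      rw [fillMem, if_neg (by omega)])
  exact ⟨(s1.seq s2).mono (by omega), hl, natAbs_fillMem_le (fun g _ => hb.2 _) hb.2⟩

theorem runs_computeParams {X U : ℕ} (hX : 2 ≤ X) (hU : 1000 * X.size ≤ U) {n L₀ L l : ℕ}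
    (hL : L = max L₀ (Nat.clog 2 n)) (hL1 : 1 ≤ L) (hLX : L ≤ X) (hNX : 2 ^ L ≤ X)
    (hl : l = hashExponent L) (hlX : 4 ^ l ≤ X) (hDX : (4 ^ l) ^ 3 ≤ X)
    (hGX : 2 ^ L * (4 ^ l) ^ 3 ≤ X) {m : ℤ → ℤ} {a : ℤ}
    (hb : BoundedBy X [a, 0, 0, 0, 0, 0, 0, 0, 0, 0, 0, (n : ℤ)] m) :
    let m' := Function.update (Function.update (Function.update m 0 ((2 ^ L : ℕ) : ℤ)) 1
      (((4 ^ l) ^ 3 : ℕ) : ℤ)) 2 ((2 ^ l : ℕ) : ℤ)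
    let regs : List ℤ := [a, ((2 ^ L * (4 ^ l) ^ 3 : ℕ) : ℤ), (((4 ^ l) ^ 3 : ℕ) : ℤ),
      ((4 ^ l : ℕ) : ℤ), l, 0, ((2 ^ l : ℕ) : ℤ), 0, 0, ((2 ^ L : ℕ) : ℤ), L, n]
    Runs U (computeParams L₀) (stateOf [a, 0, 0, 0, 0, 0, 0, 0, 0, 0, 0, n] m)
      (stateOf regs m') (10 * L + 20) ∧ BoundedBy X regs m' := by
  intro m' regs
  have hlog : Nat.log 2 L ≤ L := Nat.log_le_self 2 L
  have hlL : l ≤ L := by rw [hl]; exact Nat.div_le_self _ _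
  have h24 : 2 ^ l ≤ 4 ^ l := Nat.pow_le_pow_left (by norm_num) l
  have hL₀ : 2 ^ L₀ ≤ 2 ^ L := Nat.pow_le_pow_right (by norm_num) (by omega)
  obtain ⟨s1, b1⟩ := hb.assign_lit hX hU 9 ((2 ^ L₀ : ℕ) : ℤ) (by simp)
    (by rw [Int.natAbs_natCast]; omega)
  obtain ⟨s2, b2⟩ := b1.assign_lit hX hU 10 L₀ (by simp) (by omega)
  have s3 := runs_doubleLoop hX hU hL hLX hNX hb
  have c0 : BoundedBy X [a, 0, 0, 0, 0, 0, 0, 0, 0, ((2 ^ L : ℕ) : ℤ), (L : ℤ), (n : ℤ)] m := by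
    refine ⟨?_, hb.2⟩
    have h1 := hb.1
    simp only [List.forall_mem_cons, List.not_mem_nil, false_imp_iff, implies_true, and_true,
      Int.natAbs_natCast] at h1 ⊢
    tauto
  obtain ⟨s4, b4⟩ := c0.assign_lit hX hU 8 1 (by simp) (by omega)
  have s5 := runs_logLoop hX hU hL1 c0
  have c1 : BoundedBy X [a, 0, 0, 0, 0, 0, 0, (Nat.log 2 L : ℤ), ((2 ^ Nat.log 2 L : ℕ) : ℤ),
      ((2 ^ L : ℕ) : ℤ), (L : ℤ), (n : ℤ)] m := by
    refine ⟨?_, hb.2⟩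
    have h1 := c0.1
    have h2 : 2 ^ Nat.log 2 L ≤ L := Nat.pow_log_le_self 2 (by omega)
    simp only [List.forall_mem_cons, List.not_mem_nil, false_imp_iff, implies_true, and_true,
      Int.natAbs_natCast] at h1 ⊢
    have := h2.trans hLX
    have := hlog.trans hLX
    tauto
  obtain ⟨s6, b6⟩ := c1.assign hX hU 4 (.bin .div (.reg 10) (.reg 7)) l (by simp) (by decide)
    (by simp [Expr.val, Op.apply, stateOf, hl, hashExponent]) (by omega)
  obtain ⟨s7, b7⟩ := b6.assign_lit hX hU 8 0 (by simp) (by simp)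
  obtain ⟨s8, b8⟩ := b7.assign_lit hX hU 3 1 (by simp) (by omega)
  obtain ⟨s9, b9⟩ := b8.assign_lit hX hU 6 1 (by simp) (by omega)
  have s10 := runs_powerLoop hX hU hlX b9
  have c2 : BoundedBy X [a, 0, 0, ((4 ^ l : ℕ) : ℤ), (l : ℤ), 0, ((2 ^ l : ℕ) : ℤ),
      (Nat.log 2 L : ℤ), (l : ℤ), ((2 ^ L : ℕ) : ℤ), (L : ℤ), (n : ℤ)] m := by
    refine ⟨?_, hb.2⟩
    have h1 := c1.1
    simp only [List.forall_mem_cons, List.not_mem_nil, false_imp_iff, implies_true, and_true,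
      Int.natAbs_natCast] at h1 ⊢
    have := hlL.trans hLX
    have := h24.trans hlX
    tauto
  obtain ⟨s11, b11⟩ := c2.write hX hU (.lit 0) (.reg 9) 0 ((2 ^ L : ℕ) : ℤ) (by decide)
    rfl rfl (by rw [Int.natAbs_natCast]; omega)
  obtain ⟨s12, b12⟩ := b11.assign hX hU 2 (.bin .mul (.bin .mul (.reg 3) (.reg 3)) (.reg 3))
    (((4 ^ l) ^ 3 : ℕ) : ℤ) (by simp) (by decide)
    (by simp [Expr.val, Op.apply, stateOf, pow_succ]) (by rw [Int.natAbs_natCast]; omega)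
  obtain ⟨s13, b13⟩ := b12.write hX hU (.lit 1) (.reg 2) 1 (((4 ^ l) ^ 3 : ℕ) : ℤ) (by decide)
    rfl rfl (by rw [Int.natAbs_natCast]; omega)
  obtain ⟨s14, b14⟩ := b13.write hX hU (.lit 2) (.reg 6) 2 ((2 ^ l : ℕ) : ℤ) (by decide)
    rfl rfl (by rw [Int.natAbs_natCast]; omega)
  obtain ⟨s15, b15⟩ := b14.assign hX hU 1 (.bin .mul (.reg 9) (.reg 2))
    ((2 ^ L * (4 ^ l) ^ 3 : ℕ) : ℤ) (by simp) (by decide)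
    (by simp [Expr.val, Op.apply, stateOf]) (by rw [Int.natAbs_natCast]; omega)
  obtain ⟨s16, b16⟩ := b15.assign_lit hX hU 7 0 (by simp) (by simp)
  obtain ⟨s17, b17⟩ := b16.assign_lit hX hU 8 0 (by simp) (by simp)
  refine ⟨?_, b17⟩
  exact (s1.seq <| s2.seq <| s3.seq <| s4.seq <| s5.seq <| s6.seq <| s7.seq <| s8.seq <|
    s9.seq <| s10.seq <| s11.seq <| s12.seq <| s13.seq <| s14.seq <| s15.seq <| s16.seq s17).mono
    (by omega)

/-- The entries of a collection of vectors as integers. -/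
def hashEntryInt (Q : ℕ) (T : ResidueTest) (S : List ℤ) : ℕ → ℤ :=
  fun g => (hashEntry Q T S g).toNat

theorem natAbs_hashEntryInt_le (Q : ℕ) (T : ResidueTest) (S : List ℤ) (g : ℕ) :
    (hashEntryInt Q T S g).natAbs ≤ 1 := by
  have : ∀ b : Bool, b.toNat ≤ 1 := by decide
  simpa [hashEntryInt] using this (hashEntry Q T S g)

theorem runs_writeCollection {X U : ℕ} (hX : 2 ≤ X) (hU : 1000 * X.size ≤ U) {n G D Q : ℕ}
    (hQ : 1 ≤ Q) (hD : D = Q ^ 3) (hQX : Q + 1 ≤ X) {i : ℤ} (hi : i.natAbs ≤ 3) {test : Expr}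
    (hw : test.weight ≤ 200 ∧ test.degree ≤ 100) {T : ResidueTest} (hT : Computes test T)
    {S : List ℤ} (hSX : S.length ≤ X) {a l off dst off' dst' N L : ℤ} {m : ℤ → ℤ}
    (hl : m (i - (n + 3)) = S.length) (hoff : off + l = off') (hdst : dst + G = dst')
    (hoffX : off'.natAbs ≤ X) (hdstX : dst'.natAbs ≤ X)
    (hS : ∀ i < S.length, m (off' + i) = S.getD i 0) (hle : off' + S.length ≤ dst')
    (hb : BoundedBy X [a, (G : ℤ), (D : ℤ), (Q : ℤ), l, off, dst, 0, 0, N, L, (n : ℤ)] m) :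
    Runs U (writeCollection i test) (stateOf [a, G, D, Q, l, off, dst, 0, 0, N, L, n] m)
      (stateOf [(G : ℤ), G, D, Q, S.length, off', dst', 0, 0, N, L, n]
        (fillMem dst' G (hashEntryInt Q T S) m)) (G * (2 * Q + 9) + 5) ∧
    BoundedBy X [(G : ℤ), (G : ℤ), (D : ℤ), (Q : ℤ), (S.length : ℤ), off', dst', 0, 0, N, L,
      (n : ℤ)] (fillMem dst' G (hashEntryInt Q T S) m) := by
  have hlist := hb.1
  simp only [List.forall_mem_cons, List.not_mem_nil, false_imp_iff, implies_true, and_true] at hlist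
  obtain ⟨-, hGX, hDX, hQX', -, -, -, h0, -, hNX, hLX, hnX⟩ := hlist
  obtain ⟨s1, b1⟩ := hb.assign_lit hX hU 0 0 (by simp) (by simp)
  obtain ⟨s2, b2⟩ := b1.assign hX hU 5 (.bin .add (.reg 5) (.reg 4)) off' (by simp)
    (by decide) (by simpa [Expr.val, Op.apply, stateOf] using hoff) hoffX
  obtain ⟨s3, b3⟩ := b2.assign hX hU 4 (.read (.bin .sub (.lit i) (.bin .add (.reg 11) (.lit 3))))
    S.length (by simp) (by simp only [Expr.weight, Expr.degree]; omega)
    (by simpa [Expr.val, Op.apply, stateOf] using hl) (by omega)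
  obtain ⟨s4, b4⟩ := b3.assign hX hU 6 (.bin .add (.reg 6) (.reg 1)) dst' (by simp)
    (by decide) (by simpa [Expr.val, Op.apply, stateOf] using hdst) hdstX
  have s5 := runs_fillLoop hX hU hw hT hQ hD (G := G) (S := S) (off := off') (dst := dst')
    (a₉ := N) (a₁₀ := L) (a₁₁ := n) (by
      simp only [List.forall_mem_cons, List.not_mem_nil, false_imp_iff, implies_true, and_true]
      exact ⟨hGX, hDX, hQX, hSX, hoffX, hdstX, hNX, hLX, hnX⟩) hb.2 hS hle
  refine ⟨(s1.seq <| s2.seq <| s3.seq <| s4.seq s5).mono (by omega), ?_,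
    natAbs_fillMem_le (fun _ _ => (natAbs_hashEntryInt_le _ _ _ _).trans (by omega)) hb.2⟩
  simp only [List.forall_mem_cons, List.not_mem_nil, false_imp_iff, implies_true, and_true]
  exact ⟨hGX, hGX, hDX, hQX', hSX, hoffX, hdstX, h0, h0, hNX, hLX, hnX⟩

theorem runs_writeCollections {X U : ℕ} (hX : 2 ≤ X) (hU : 1000 * X.size ≤ U) {n G D Q : ℕ}
    (hn : n ≤ X) (hQ : 1 ≤ Q) (hD : D = Q ^ 3) (hQX : Q + 1 ≤ X) (hGX : 3 + 3 * G ≤ X)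
    {S₁ S₂ S₃ : List ℤ} (hS : S₁.length + S₂.length + S₃.length = n) {a l s N L : ℤ} {m : ℤ → ℤ}
    (hl₁ : m (0 - (n + 3)) = S₁.length) (hl₂ : m (1 - (n + 3)) = S₂.length)
    (hl₃ : m (2 - (n + 3)) = S₃.length)
    (hS₁ : ∀ i < S₁.length, m (-n + i) = S₁.getD i 0)
    (hS₂ : ∀ i < S₂.length, m (-n + S₁.length + i) = S₂.getD i 0)
    (hS₃ : ∀ i < S₃.length, m (-n + S₁.length + S₂.length + i) = S₃.getD i 0)
    (hb : BoundedBy X [a, (G : ℤ), (D : ℤ), (Q : ℤ), l, 0, s, 0, 0, N, L, (n : ℤ)] m) :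
    let m' := fillMem (3 + G + G) G (hashEntryInt Q thirdTest S₃)
      (fillMem (3 + G) G (hashEntryInt Q secondTest S₂)
        (fillMem 3 G (hashEntryInt Q firstTest S₁) m))
    let regs : List ℤ := [(G : ℤ), G, D, Q, S₃.length, -n + S₁.length + S₂.length, 3 + G + G, 0, 0,
      N, L, n]
    Runs U writeCollections (stateOf [a, G, D, Q, l, 0, s, 0, 0, N, L, n] m)
      (stateOf regs m') (3 * (G * (2 * Q + 9)) + 18) ∧ BoundedBy X regs m' := by
  intro m' regs
  obtain ⟨s1, b1⟩ := hb.assign_lit hX hU 4 0 (by simp) (by simp)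
  obtain ⟨s2, b2⟩ := b1.assign hX hU 5 (.bin .sub (.lit 0) (.reg 11))
    (-n) (by simp) (by decide) (by simp [Expr.val, Op.apply, stateOf]) (by omega)
  -- `writeCollection` first advances its destination by `G`, so starting at `3 - G` puts the first
  -- collection right after the three header cells.
  obtain ⟨s3, b3⟩ := b2.assign hX hU 6 (.bin .sub (.lit 3) (.reg 1))
    (3 - G) (by simp) (by decide) (by simp [Expr.val, Op.apply, stateOf]) (by omega)
  obtain ⟨s4, b4⟩ := runs_writeCollection hX hU hQ hD hQX (i := 0) (by decide) (by decide)
    computes_firstTestExpr (S := S₁) (by omega) (off' := -n) (dst' := 3) hl₁ (by ring) (by ring)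
    (by omega) (by omega) hS₁ (by omega) b3
  obtain ⟨s5, b5⟩ := runs_writeCollection hX hU hQ hD hQX (i := 1) (by decide) (by decide)
    computes_secondTestExpr (S := S₂) (by omega) (by rw [fillMem, if_neg (by omega), hl₂]) rfl rfl
    (by omega) (by omega) (fun i hi => by rw [fillMem, if_neg (by omega), hS₂ i hi]) (by omega) b4
  obtain ⟨s6, b6⟩ := runs_writeCollection hX hU hQ hD hQX (i := 2) (by decide) (by decide)
    computes_thirdTestExpr (S := S₃) (by omega)
    (by rw [fillMem, if_neg (by omega), fillMem, if_neg (by omega), hl₃]) rfl rfl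
    (by omega) (by omega)
    (fun i hi => by rw [fillMem, if_neg (by omega), fillMem, if_neg (by omega), hS₃ i hi])
    (by omega) b5
  exact ⟨(s1.seq <| s2.seq <| s3.seq <| s4.seq <| s5.seq s6).mono (by omega), b6⟩

/-- The distinguisher is only specified on initial states, so all registers and scratch cells must
be zero again. -/
theorem runs_cleanUp {X U : ℕ} (hX : 2 ≤ X) (hU : 1000 * X.size ≤ U) {n : ℕ} (hn : n + 3 ≤ X)
    {a₀ a₁ a₂ a₃ a₄ a₅ a₆ a₉ a₁₀ : ℤ} {m : ℤ → ℤ}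
    (hb : BoundedBy X [a₀, a₁, a₂, a₃, a₄, a₅, a₆, 0, 0, a₉, a₁₀, (n : ℤ)] m) :
    Runs U cleanUp (stateOf [a₀, a₁, a₂, a₃, a₄, a₅, a₆, 0, 0, a₉, a₁₀, (n : ℤ)] m)
      (stateOf [0, 0, 0, 0, 0, 0, 0, 0, 0, 0, 0, 0]
        (fillMem (-((n + 3 : ℕ) : ℤ)) (n + 3) (fun _ => 0) m)) ((n + 3) * 3 + 12) := by
  obtain ⟨s0, b0⟩ := hb.assign_lit hX hU 0 0 (by simp) (by simp)
  have c0 : BoundedBy X [((n + 3 : ℕ) : ℤ), a₁, a₂, a₃, a₄, a₅, a₆, 0, 0, a₉, a₁₀, (n : ℤ)]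
      (fillMem (-((n + 3 : ℕ) : ℤ)) (n + 3) (fun _ => 0) m) := by
    refine ⟨?_, natAbs_fillMem_le (by simp) hb.2⟩
    have h1 := hb.1
    rw [List.forall_mem_cons] at h1 ⊢
    exact ⟨by omega, h1.2⟩
  have s1 := runs_shiftLoop hX hU (e := .lit 0) (by decide) (F := fun _ => 0) c0.1 hb.2
    (by simp) (fun g hg => rfl)
  obtain ⟨s2, b2⟩ := c0.assign_lit hX hU 0 0 (by simp) (by simp)
  obtain ⟨s3, b3⟩ := b2.assign_lit hX hU 1 0 (by simp) (by simp)
  obtain ⟨s4, b4⟩ := b3.assign_lit hX hU 2 0 (by simp) (by simp)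
  obtain ⟨s5, b5⟩ := b4.assign_lit hX hU 3 0 (by simp) (by simp)
  obtain ⟨s6, b6⟩ := b5.assign_lit hX hU 4 0 (by simp) (by simp)
  obtain ⟨s7, b7⟩ := b6.assign_lit hX hU 5 0 (by simp) (by simp)
  obtain ⟨s8, b8⟩ := b7.assign_lit hX hU 6 0 (by simp) (by simp)
  obtain ⟨s9, b9⟩ := b8.assign_lit hX hU 9 0 (by simp) (by simp)
  obtain ⟨s10, b10⟩ := b9.assign_lit hX hU 10 0 (by simp) (by simp)
  obtain ⟨s11, -⟩ := b10.assign_lit hX hU 11 0 (by simp) (by simp)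
  exact (s0.seq <| s1.seq <| s2.seq <| s3.seq <| s4.seq <| s5.seq <| s6.seq <| s7.seq <|
    s8.seq <| s9.seq <| s10.seq s11).mono (by omega)

end RAM

/-! ### The final memory is the input of the target instance -/

namespace RAM

theorem init_eq_stateOf (input : List ℤ) :
    init input = stateOf [0, 0, 0, 0, 0, 0, 0, 0, 0, 0, 0, 0] (init input).mem := by
  have : (fun i => ([0, 0, 0, 0, 0, 0, 0, 0, 0, 0, 0, 0] : List ℤ).getD i 0) = fun _ => 0 := by
    funext i
    change (List.replicate 12 (0 : ℤ)).getD i 0 = 0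
    rw [List.getD_eq_getElem?_getD, List.getElem?_replicate]
    split_ifs <;> rfl
  rw [stateOf, this]
  rfl

theorem init_mem_natCast (input : List ℤ) (i : ℕ) : (init input).mem i = input.getD i 0 := by
  simp [init]

/-- The flattened matrix is a function of the single index `g = i * D + j`, the form in which
`fillLoop` writes it. -/
theorem vectorEntries_hashVectors {Q N D : ℕ} (T : ResidueTest) (S : List ℤ) :
    vectorEntries (hashVectors Q N D T S) =
      List.ofFn fun g : Fin (N * D) => hashEntryInt Q T S g := by
  rw [List.ofFn_mul]
  rfl

theorem getD_ofFn_append {n i : ℕ} (F : ℕ → ℤ) (l : List ℤ) :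
    ((List.ofFn fun g : Fin n => F g) ++ l).getD i 0 = if i < n then F i else l.getD (i - n) 0 := by
  split_ifs with h
  · rw [List.getD_append _ _ _ _ (by simpa using h)]
    simp [h]
  · rw [List.getD_append_right _ _ _ _ (by simpa using h)]
    simp

/-- `hn` guarantees that the new instance overwrites every cell of the old input; the copy at
negative addresses is erased last. -/
theorem init_mipInput_mem {Q N D s n : ℕ} {S₁ S₂ S₃ : List ℤ} {m : ℤ → ℤ}
    (hm : ∀ a : ℤ, a < -((n + 3 : ℕ) : ℤ) ∨ n + 3 ≤ a → m a = 0) (hn : n ≤ N * D) :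
    fillMem (-((n + 3 : ℕ) : ℤ)) (n + 3) (fun _ => 0)
      (fillMem (3 + (N * D : ℕ) + (N * D : ℕ)) (N * D) (hashEntryInt Q thirdTest S₃)
        (fillMem (3 + (N * D : ℕ)) (N * D) (hashEntryInt Q secondTest S₂)
          (fillMem 3 (N * D) (hashEntryInt Q firstTest S₁)
            (Function.update (Function.update (Function.update m 0 N) 1 D) 2 s)))) =
    (init (mipInput (hashVectors Q N D firstTest S₁) (hashVectors Q N D secondTest S₂)
      (hashVectors Q N D thirdTest S₃) s)).mem := by
  funext a
  rcases lt_or_ge a 0 with ha | ha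
  · have h0 : (init (mipInput (hashVectors Q N D firstTest S₁) (hashVectors Q N D secondTest S₂)
      (hashVectors Q N D thirdTest S₃) s)).mem a = 0 := if_neg (by omega)
    rw [h0, fillMem]
    split_ifs with h
    · rfl
    · rw [fillMem, if_neg (by omega), fillMem, if_neg (by omega), fillMem, if_neg (by omega),
        Function.update_of_ne (by omega), Function.update_of_ne (by omega),
        Function.update_of_ne (by omega), hm a (by omega)]
  · obtain ⟨i, rfl⟩ := Int.eq_ofNat_of_zero_le ha
    rw [init_mem_natCast, mipInput, vectorEntries_hashVectors, vectorEntries_hashVectors,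
      vectorEntries_hashVectors, List.append_assoc, List.append_assoc]
    generalize N * D = G at *
    rw [fillMem, if_neg (by omega)]
    rcases lt_or_ge i 3 with h3 | h3
    · rw [fillMem, if_neg (by omega), fillMem, if_neg (by omega), fillMem, if_neg (by omega)]
      interval_cases i <;> simp
    · obtain ⟨i, rfl⟩ : ∃ j, i = 3 + j := ⟨i - 3, by omega⟩
      have hright : ∀ l : List ℤ, ([(N : ℤ), (D : ℤ), (s : ℤ)] ++ l).getD (3 + i) 0 = l.getD i 0 := by
        intro l
        rw [List.getD_append_right _ _ _ _ (by simp)]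
        simp
      rw [hright, getD_ofFn_append, getD_ofFn_append, ← List.append_nil (List.ofFn _),
        getD_ofFn_append, List.getD_nil]
      split_ifs with h₁ h₂ h₃
      · rw [fillMem, if_neg (by omega), fillMem, if_neg (by omega), fillMem, if_pos (by omega)]
        congr 1
        omega
      · rw [fillMem, if_neg (by omega), fillMem, if_pos (by omega)]
        congr 1
        omega
      · rw [fillMem, if_pos (by omega)]
        congr 1
        omega
      · rw [fillMem, if_neg (by omega), fillMem, if_neg (by omega), fillMem, if_neg (by omega),
          Function.update_of_ne (by omega), Function.update_of_ne (by omega),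
          Function.update_of_ne (by omega), hm _ (by omega)]

/-- The work is writing `3 * N * D` entries at `O(Q)` steps each, and `D * Q = Q ^ 4`; the factor
200 absorbs the lower-order terms. -/
theorem runs_reduction {L₀ n L l D : ℕ} {S₁ S₂ S₃ : List ℤ} (hn : 1 ≤ n)
    (hS : S₁.length + S₂.length + S₃.length = n) (hx : ∀ x ∈ S₁ ++ S₂ ++ S₃, |x| ≤ (n : ℤ) ^ 6)
    (hL : L = max L₀ (Nat.clog 2 n)) (hL1 : 1 ≤ L) (hl : l = hashExponent L) (hlL : 6 * l ≤ L)
    (hD : D = (4 ^ l) ^ 3) :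
    Runs (1000 * (6 * L + 4)) (reduction L₀) (init (threeSumInput S₁ S₂ S₃))
      (init (mipInput (hashVectors (4 ^ l) (2 ^ L) D firstTest S₁)
        (hashVectors (4 ^ l) (2 ^ L) D secondTest S₂)
        (hashVectors (4 ^ l) (2 ^ L) D thirdTest S₃) (2 ^ l))) (200 * (2 ^ L * (4 ^ l) ^ 4)) := by
  set N := 2 ^ L with hN
  set Q := 4 ^ l with hQ
  -- `X = 8 * N ^ 6` dominates the input integers, at most `N ^ 6`, and all addresses, which are of
  -- order `N * D ≤ N ^ 2`. Its bit length is `6 * L + 4`.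
  set X := 2 ^ (6 * L + 3) with hXdef
  have hXN : X = 8 * N ^ 6 := by rw [hXdef, hN, pow_add, mul_comm 6 L, pow_mul]; ring
  have hQ1 : 1 ≤ Q := Nat.one_le_pow _ _ (by norm_num)
  have hN2 : 2 ≤ N := by
    calc 2 = 2 ^ 1 := rfl
      _ ≤ 2 ^ L := Nat.pow_le_pow_right (by norm_num) hL1
  have hnN : n ≤ N := by
    rw [hN, ← Nat.clog_le_iff_le_pow (by norm_num)]
    omega
  have hLN : L < N := Nat.lt_two_pow_self
  have hDN : D ≤ N := by
    have : D = 2 ^ (6 * l) := by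
      rw [hD, hQ, ← pow_mul, show (4 : ℕ) = 2 ^ 2 by norm_num, ← pow_mul]
      congr 1
      ring
    rw [this]
    exact Nat.pow_le_pow_right (by norm_num) hlL
  have hQD : Q ≤ D := by rw [hD]; exact Nat.le_self_pow (by norm_num) Q
  have hGN : N * D ≤ N ^ 2 := by rw [pow_two]; exact Nat.mul_le_mul_left _ hDN
  have hN26 : N ^ 2 ≤ N ^ 6 := Nat.pow_le_pow_right (by omega) (by norm_num)
  have hN12 : 2 * N ≤ N ^ 2 := by rw [pow_two]; exact Nat.mul_le_mul_right _ hN2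
  have hX : 2 ≤ X := by omega
  have hU : 1000 * X.size ≤ 1000 * (6 * L + 4) := by rw [hXdef, Nat.size_pow]
  set inp := threeSumInput S₁ S₂ S₃ with hinp
  set m := (init inp).mem with hm
  have hinpX : ∀ a, (m a).natAbs ≤ X := by
    have hmem : ∀ x ∈ inp, x.natAbs ≤ X := by
      intro x hxi
      simp only [hinp, threeSumInput, List.append_assoc] at hxi
      rw [List.mem_append, ← List.append_assoc] at hxi
      rcases hxi with hxi | hxi
      · simp only [List.mem_cons, List.not_mem_nil, or_false] at hxi
        omega
      · have h1 := hx x hxi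
        rw [Int.abs_eq_natAbs] at h1
        have h2 : x.natAbs ≤ n ^ 6 := by exact_mod_cast h1
        have h3 : n ^ 6 ≤ N ^ 6 := Nat.pow_le_pow_left hnN 6
        omega
    intro a
    simp only [hm, init]
    split_ifs
    · rw [List.getD_eq_getElem?_getD]
      rcases lt_or_ge a.toNat inp.length with h | h
      · simpa [h] using hmem _ (List.getElem_mem h)
      · simp [h]
    · simp
  have hlen : inp.length = n + 3 := by
    simp [hinp, threeSumInput]
    omega
  have hmD : ∀ i : ℕ, m i = inp.getD i 0 := init_mem_natCast inp
  have hi0 : m 0 = S₁.length := hmD 0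
  have hi1 : m 1 = S₂.length := hmD 1
  have hi2 : m 2 = S₃.length := hmD 2
  have hi3 : ∀ i < S₁.length, m ((3 + i : ℕ) : ℤ) = S₁.getD i 0 := by
    intro i hi
    rw [hmD, hinp, threeSumInput, List.append_assoc, List.append_assoc,
      List.getD_append_right _ _ _ _ (by simp), List.getD_append _ _ _ _ (by simpa using hi)]
    simp
  have hi4 : ∀ i < S₂.length, m ((3 + S₁.length + i : ℕ) : ℤ) = S₂.getD i 0 := by
    intro i hi
    rw [hmD, hinp, threeSumInput, List.append_assoc,
      List.getD_append_right _ _ _ _ (by simp; omega),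
      List.getD_append _ _ _ _ (by simp; omega)]
    congr 1
    simp
    omega
  have hi5 : ∀ i < S₃.length, m ((3 + S₁.length + S₂.length + i : ℕ) : ℤ) = S₃.getD i 0 := by
    intro i hi
    rw [hmD, hinp, threeSumInput, List.getD_append_right _ _ _ _ (by simp; omega)]
    congr 1
    simp
    omega
  have hzero : ∀ a : ℤ, a < 0 ∨ n + 3 ≤ a → m a = 0 := by
    intro a ha
    simp only [hm, init]
    split_ifs with h
    · rw [List.getD_eq_default _ _ (by omega)]
    · rfl
  have b0 : BoundedBy X [0, 0, 0, 0, 0, 0, 0, 0, 0, 0, 0, 0] m := ⟨by simp, hinpX⟩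
  obtain ⟨s1, b1⟩ := runs_copyInput hX hU (n := n) (by omega) b0 (by rw [hi0, hi1, hi2]; omega)
  obtain ⟨s2, b2⟩ := runs_computeParams hX hU hL hL1 (by omega) (by omega) hl
    (by omega) (by rw [← hQ, ← hD]; omega) (by rw [← hN, ← hQ, ← hD]; omega) b1
  rw [← hN, ← hQ, ← hD] at s2 b2
  set m₁ := fillMem (-((n + 3 : ℕ) : ℤ)) (n + 3) (fun i => m i) m with hm₁
  have hcopy : ∀ i : ℕ, i < n + 3 → ∀ a : ℤ, a = i - (n + 3) →
      Function.update (Function.update (Function.update m₁ 0 (N : ℤ)) 1 (D : ℤ)) 2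
        ((2 ^ l : ℕ) : ℤ) a = m i := by
    intro i hi a ha
    rw [Function.update_of_ne (by omega), Function.update_of_ne (by omega),
      Function.update_of_ne (by omega), hm₁, fillMem, if_pos (by omega)]
    congr 1
    omega
  obtain ⟨s3, b3⟩ := runs_writeCollections hX hU (n := n) (S₁ := S₁) (S₂ := S₂) (S₃ := S₃)
    (by omega) hQ1 hD (by omega) (by omega) hS
    (by rw [hcopy 0 (by omega) _ (by simp)]; exact hi0)
    (by rw [hcopy 1 (by omega) _ (by simp)]; exact hi1)
    (by rw [hcopy 2 (by omega) _ (by simp)]; exact hi2)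
    (fun i hi => by rw [hcopy (3 + i) (by omega) _ (by omega), hi3 i hi])
    (fun i hi => by rw [hcopy (3 + S₁.length + i) (by omega) _ (by omega), hi4 i hi])
    (fun i hi => by rw [hcopy (3 + S₁.length + S₂.length + i) (by omega) _ (by omega), hi5 i hi])
    b2
  have s4 := runs_cleanUp hX hU (n := n) (by omega) b3
  have hND : n ≤ N * D := hnN.trans (Nat.le_mul_of_pos_right _ (by omega))
  have hfinal := init_mipInput_mem (Q := Q) (N := N) (D := D) (s := 2 ^ l) (n := n) (S₁ := S₁)
    (S₂ := S₂) (S₃ := S₃) (m := m₁) (fun a ha => by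
      rw [hm₁, fillMem, if_neg (by omega), hzero a (by omega)]) hND
  rw [hfinal, ← init_eq_stateOf] at s4
  have key := s1.seq (s2.seq (s3.seq s4))
  rw [hm, ← init_eq_stateOf] at key
  refine key.mono ?_
  have hDQ : D * Q = Q ^ 4 := by rw [hD]; ring
  have e1 : N ≤ N * Q ^ 4 := Nat.le_mul_of_pos_right _ (by positivity)
  have e2 : N * D ≤ N * Q ^ 4 := by
    rw [← hDQ]
    exact Nat.mul_le_mul_left _ (Nat.le_mul_of_pos_right _ (by omega))
  have e3 : N * D * (2 * Q + 9) = 2 * (N * Q ^ 4) + 9 * (N * D) := by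
    rw [← hDQ]
    ring
  rw [e3]
  omega

end RAM

/-! ## Dimension and gap -/

/-- The iterated logarithm that governs the parameters for `N` vectors. -/
def logLog (N : ℕ) : ℕ := Nat.log 2 (Nat.log 2 N)

/-- The dimension of the vectors. -/
def hashDim (N : ℕ) : ℕ := 2 ^ (6 * RAM.hashExponent (Nat.log 2 N))

/-- The exponent of the dimension. -/
noncomputable def dimExponent (N : ℕ) : ℝ :=
  6 * RAM.hashExponent (Nat.log 2 N) / Real.logb 2 N

/-- The loss in the exponent of the gap. -/
noncomputable def gapLoss (N : ℕ) : ℝ := Real.logb 2 (4 * logLog N) / logLog N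

theorem tendsto_natLog_atTop : Tendsto (Nat.log 2) atTop atTop :=
  tendsto_atTop_atTop.2 fun b => ⟨2 ^ b, fun _ ha => Nat.le_log_of_pow_le (by norm_num) ha⟩

theorem tendsto_logLog_atTop : Tendsto logLog atTop atTop :=
  tendsto_natLog_atTop.comp tendsto_natLog_atTop

theorem tendsto_gapLoss : Tendsto gapLoss atTop (𝓝 0) := by
  have h1 : Tendsto (fun x : ℝ => Real.log x / x) atTop (𝓝 0) :=
    Real.isLittleO_log_id_atTop.tendsto_div_nhds_zero
  have h2 : Tendsto (fun N => (4 : ℝ) * logLog N) atTop atTop :=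
    (tendsto_natCast_atTop_atTop.comp tendsto_logLog_atTop).const_mul_atTop (by norm_num)
  have h3 := (h1.comp h2).mul_const (4 / Real.log 2)
  rw [zero_mul] at h3
  refine h3.congr fun N => ?_
  simp only [Function.comp, gapLoss, Real.logb]
  rcases eq_or_ne (logLog N : ℝ) 0 with h0 | h0
  · simp [h0]
  · have : Real.log 2 ≠ 0 := (Real.log_pos (by norm_num)).ne'
    field_simp

theorem hashExponent_mul_le (L : ℕ) : RAM.hashExponent L * Nat.log 2 L ≤ L :=
  Nat.div_mul_le_self _ _

theorem natLog_le_logb {N : ℕ} (hN : 1 ≤ N) : (Nat.log 2 N : ℝ) ≤ Real.logb 2 N := by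
  rw [Real.le_logb_iff_rpow_le (by norm_num) (by exact_mod_cast hN), Real.rpow_natCast]
  exact_mod_cast Nat.pow_log_le_self 2 (by omega)

/-- Since `l * log L ≤ L`, the exponent is at most `6 / logLog N`. -/
theorem tendsto_dimExponent : Tendsto dimExponent atTop (𝓝 0) := by
  have h1 : Tendsto (fun N => (6 : ℝ) / logLog N) atTop (𝓝 0) :=
    tendsto_const_nhds.div_atTop (tendsto_natCast_atTop_atTop.comp tendsto_logLog_atTop)
  refine tendsto_of_tendsto_of_tendsto_of_le_of_le' tendsto_const_nhds h1 ?_ ?_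
  · filter_upwards [eventually_ge_atTop 1] with N hN
    exact div_nonneg (by positivity) ((Nat.cast_nonneg _).trans (natLog_le_logb hN))
  · filter_upwards [eventually_ge_atTop 1, tendsto_logLog_atTop.eventually_ge_atTop 1] with N hN hk
    have hk0 : (0 : ℝ) < logLog N := by exact_mod_cast hk
    have hL0 : 0 < Nat.log 2 N := by
      by_contra h0
      have : Nat.log 2 N = 0 := by omega
      rw [logLog, this] at hk
      simp at hk
    have hL : (0 : ℝ) < Nat.log 2 N := by exact_mod_cast hL0
    have hle := natLog_le_logb hN
    rw [dimExponent, div_le_div_iff₀ (hL.trans_le hle) hk0, mul_assoc]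
    have : (RAM.hashExponent (Nat.log 2 N) : ℝ) * logLog N ≤ Nat.log 2 N := by
      exact_mod_cast hashExponent_mul_le (Nat.log 2 N)
    linarith

theorem hashDim_eq_rpow {N : ℕ} (hN : 2 ≤ N) : (hashDim N : ℝ) = (N : ℝ) ^ dimExponent N := by
  have hN0 : (0 : ℝ) < N := by positivity
  have hlog : Real.logb 2 N ≠ 0 := (Real.logb_pos (by norm_num) (by exact_mod_cast hN)).ne'
  nth_rewrite 1 [← Real.rpow_logb (b := 2) (by norm_num) (by norm_num) hN0]
  rw [← Real.rpow_mul (by norm_num), dimExponent, mul_div_cancel₀ _ hlog, hashDim]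
  push_cast
  rw [← Real.rpow_natCast]
  push_cast
  rfl

theorem hashDim_two_pow (L : ℕ) : hashDim (2 ^ L) = (4 ^ RAM.hashExponent L) ^ 3 := by
  rw [hashDim, Nat.log_pow (by norm_num), ← pow_mul, show (4 : ℕ) = 2 ^ 2 by norm_num, ← pow_mul]
  congr 1
  ring

theorem four_mul_mul_add_five_le_two_pow {k : ℕ} (hk : 8 ≤ k) : 4 * k * (k + 5) ≤ 3 * 2 ^ k := by
  induction k, hk using Nat.le_induction with
  | base => norm_num
  | succ k hk ih => rw [pow_succ]; nlinarith

/-- Put `k = ⌊log L⌋`. The loss is chosen so that `(2 ^ k) ^ gapLoss = 4 * k`, whence `L ^ (1 -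
gapLoss) ≤ L / (4 * k)`. As `l` is about `L / k`, three quarters of it remain to pay for the factor
`6 * L + 2 ≤ 2 ^ (k + 4)`. -/
theorem le_two_pow_div_gap {L : ℕ} (hk : 8 ≤ Nat.log 2 L) :
    ((6 * L + 2 : ℕ) : ℝ) ≤ ((2 ^ RAM.hashExponent L : ℕ) : ℝ) /
      (2 : ℝ) ^ (Real.logb 2 ((2 ^ L : ℕ) : ℝ) ^ (1 - gapLoss (2 ^ L))) := by
  have hL0 : L ≠ 0 := by
    rintro rfl
    simp at hk
  have hlogb : Real.logb 2 ((2 ^ L : ℕ) : ℝ) = L := by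
    push_cast
    rw [Real.logb_pow, Real.logb_self_eq_one (by norm_num), mul_one]
  have hloss : gapLoss (2 ^ L) = Real.logb 2 (4 * Nat.log 2 L) / Nat.log 2 L := by
    rw [gapLoss, logLog, Nat.log_pow (by norm_num)]
  set k := Nat.log 2 L with hkdef
  set l := RAM.hashExponent L with hl
  have hkR : (8 : ℝ) ≤ k := by exact_mod_cast hk
  have hLR : (0 : ℝ) < L := by positivity
  have hlow : 2 ^ k ≤ L := Nat.pow_log_le_self 2 hL0
  have hhigh : L < 2 ^ (k + 1) := Nat.lt_pow_succ_log_self (by norm_num) L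
  have hgap : (L : ℝ) ^ (1 - gapLoss (2 ^ L)) ≤ L / (4 * k) := by
    rw [Real.rpow_sub hLR, Real.rpow_one]
    refine div_le_div_of_nonneg_left hLR.le (by positivity) ?_
    have h1 : (4 * k : ℝ) = ((2 : ℝ) ^ k) ^ gapLoss (2 ^ L) := by
      rw [← Real.rpow_natCast, ← Real.rpow_mul (by norm_num), hloss,
        mul_div_cancel₀ _ (by positivity), Real.rpow_logb (by norm_num) (by norm_num)
          (by positivity)]
    have h2 : 0 ≤ gapLoss (2 ^ L) := by
      rw [hloss]
      exact div_nonneg (Real.logb_nonneg (by norm_num) (by linarith)) (by positivity)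
    rw [h1]
    exact Real.rpow_le_rpow (by positivity) (by exact_mod_cast hlow) h2
  have hl1 : (L : ℝ) ≤ k * (l + 1) := by
    have : L < k * (l + 1) := Nat.lt_mul_div_succ L (by omega)
    exact_mod_cast this.le
  -- From `L / k - 1 ≤ l` it suffices that `k + 5 ≤ 3 * L / (4 * k)`, which follows from `L ≥ 2 ^
  -- k`.
  have hexp : (k : ℝ) + 4 + L / (4 * k) ≤ l := by
    have h1 : (4 * k * (k + 5) : ℝ) ≤ 3 * L := by
      have := (four_mul_mul_add_five_le_two_pow hk).trans (Nat.mul_le_mul_left 3 hlow)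
      exact_mod_cast this
    have h2 : (k : ℝ) + 4 + L / (4 * k) = (4 * k * (k + 4) + L) / (4 * k) := by
      field_simp
    rw [h2, div_le_iff₀ (by positivity)]
    nlinarith
  rw [hlogb, le_div_iff₀ (by positivity)]
  have h3 : ((6 * L + 2 : ℕ) : ℝ) ≤ (2 : ℝ) ^ ((k : ℝ) + 4) := by
    have : 6 * L + 2 ≤ 2 ^ (k + 4) := by
      have : 2 ^ (k + 4) = 2 ^ (k + 1) * 8 := by ring
      omega
    have h4 : ((6 * L + 2 : ℕ) : ℝ) ≤ ((2 ^ (k + 4) : ℕ) : ℝ) := Nat.cast_le.2 this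
    refine h4.trans_eq ?_
    push_cast
    rw [← Real.rpow_natCast]
    push_cast
    rfl
  calc ((6 * L + 2 : ℕ) : ℝ) * (2 : ℝ) ^ ((L : ℝ) ^ (1 - gapLoss (2 ^ L)))
      ≤ (2 : ℝ) ^ ((k : ℝ) + 4) * (2 : ℝ) ^ ((L : ℝ) / (4 * k)) :=
        mul_le_mul h3 (Real.rpow_le_rpow_of_exponent_le (by norm_num) hgap) (by positivity)
          (by positivity)
    _ = (2 : ℝ) ^ ((k : ℝ) + 4 + L / (4 * k)) := by rw [← Real.rpow_add (by norm_num)]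
    _ ≤ (2 : ℝ) ^ (l : ℝ) := Real.rpow_le_rpow_of_exponent_le (by norm_num) hexp
    _ = ((2 ^ l : ℕ) : ℝ) := by
      push_cast
      rw [Real.rpow_natCast]

/-! ## Running time -/

/-- From `32 * l ≤ L`, `Q ^ 4 = 2 ^ (8 * l)` is at most `N ^ (1 / 4)`. The logarithmic factor is
`O(N ^ (1 / 4))` by Bernoulli's inequality, for a total of `O(N ^ (3 / 2))`. -/
theorem reduction_cost_le {L : ℕ} (hk : 32 ≤ Nat.log 2 L) :
    ((200 * (2 ^ L * (4 ^ RAM.hashExponent L) ^ 4) * (1000 * (6 * L + 4)) : ℕ) : ℝ) ≤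
      4800000 * ((2 ^ L : ℕ) : ℝ) ^ (3 / 2 : ℝ) := by
  set l := RAM.hashExponent L
  have h32 : l * 32 ≤ L := (Nat.mul_le_mul_left _ hk).trans (hashExponent_mul_le L)
  have hL : 2 ^ 32 ≤ L := Nat.pow_le_of_le_log (by rintro rfl; simp at hk) hk
  have hpow : ∀ x : ℝ, ((2 ^ L : ℕ) : ℝ) ^ x = (2 : ℝ) ^ (L * x) := by
    intro x
    push_cast
    rw [← Real.rpow_natCast, ← Real.rpow_mul (by norm_num)]
  have h1 : (((4 ^ l) ^ 4 : ℕ) : ℝ) ≤ ((2 ^ L : ℕ) : ℝ) ^ (1 / 4 : ℝ) := by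
    have : (((4 ^ l) ^ 4 : ℕ) : ℝ) = (2 : ℝ) ^ ((l * 8 : ℕ) : ℝ) := by
      rw [Real.rpow_natCast, ← pow_mul, show (4 : ℕ) = 2 ^ 2 by norm_num, ← pow_mul]
      push_cast
      congr 1
      ring
    rw [this, hpow]
    refine Real.rpow_le_rpow_of_exponent_le (by norm_num) ?_
    have : (l : ℝ) * 32 ≤ L := by exact_mod_cast h32
    push_cast
    linarith
  have h2 : ((6 * L + 4 : ℕ) : ℝ) ≤ 24 * ((2 ^ L : ℕ) : ℝ) ^ (1 / 4 : ℝ) := by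
    have h4 : (4 : ℝ) ≤ L := by exact_mod_cast (by omega : 4 ≤ L)
    have := one_add_mul_self_le_rpow_one_add (s := 1) (by norm_num) (p := L * (1 / 4 : ℝ))
      (by linarith)
    rw [hpow]
    norm_num at this ⊢
    linarith
  have h3 : ((2 ^ L : ℕ) : ℝ) ^ (3 / 2 : ℝ) =
      ((2 ^ L : ℕ) : ℝ) * ((2 ^ L : ℕ) : ℝ) ^ (1 / 4 : ℝ) * ((2 ^ L : ℕ) : ℝ) ^ (1 / 4 : ℝ) := by
    nth_rewrite 2 [← Real.rpow_one ((2 ^ L : ℕ) : ℝ)]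
    rw [← Real.rpow_add (by positivity), ← Real.rpow_add (by positivity)]
    norm_num
  calc ((200 * (2 ^ L * (4 ^ l) ^ 4) * (1000 * (6 * L + 4)) : ℕ) : ℝ)
      = 200000 * ((2 ^ L : ℕ) : ℝ) * ((((4 ^ l) ^ 4 : ℕ) : ℝ) * ((6 * L + 4 : ℕ) : ℝ)) := by
        push_cast
        ring
    _ ≤ 200000 * ((2 ^ L : ℕ) : ℝ) * (((2 ^ L : ℕ) : ℝ) ^ (1 / 4 : ℝ) *
          (24 * ((2 ^ L : ℕ) : ℝ) ^ (1 / 4 : ℝ))) := by gcongr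
    _ = _ := by rw [h3]; ring

theorem two_pow_max_clog_le {n L₀ : ℕ} (hn : 1 ≤ n) :
    2 ^ max L₀ (Nat.clog 2 n) ≤ 2 ^ (L₀ + 1) * n := by
  have h1 : 2 ^ Nat.clog 2 n ≤ 2 * n := by
    rcases hn.eq_or_lt with rfl | hn
    · simp
    · have h2 := Nat.pow_pred_clog_lt_self (b := 2) (by norm_num) hn
      have h3 : 0 < Nat.clog 2 n := Nat.clog_pos (by norm_num) hn
      obtain ⟨c, hc⟩ : ∃ c, Nat.clog 2 n = c + 1 := ⟨_, (Nat.succ_pred_eq_of_pos h3).symm⟩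
      rw [hc] at h2 ⊢
      rw [pow_succ]
      simp only [Nat.pred_succ] at h2
      omega
  have h4 : 1 ≤ 2 ^ L₀ := Nat.one_le_two_pow
  rw [pow_succ]
  rcases max_choice L₀ (Nat.clog 2 n) with h | h <;> rw [h] <;> nlinarith

/-! ### From a distinguisher to a 3-SUM algorithm -/

/-- The saving is capped at `1 / 2` because the reduction itself is only bounded by `N ^ (3 / 2)`.
Since `N ≤ 2 ^ (L₀ + 1) * n`, a bound in `N` becomes one in `n` up to a constant. -/
theorem solvesThreeSum_of_distinguishesGapMIP {p : RAM.Prog} {K ε : ℝ}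
    (hp : DistinguishesGapMIP p hashDim
      (fun N => (2 : ℝ) ^ ((Real.logb 2 (N : ℝ)) ^ (1 - gapLoss N)))
      (fun N => K * (N : ℝ) ^ (2 - ε))) {L₀ : ℕ} (hL₀ : 2 ^ 32 ≤ L₀) :
    SolvesThreeSum (.seq (RAM.reduction L₀) p) (fun n =>
      (4800000 + |K|) * ((2 ^ (L₀ + 1) : ℕ) : ℝ) ^ (2 - min ε (1 / 2)) *
        (n : ℝ) ^ (2 - min ε (1 / 2))) := by
  intro n S₁ S₂ S₃ hn hS _ _ _ hx
  obtain ⟨L, hL⟩ : ∃ L, L = max L₀ (Nat.clog 2 n) := ⟨_, rfl⟩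
  have hLL₀ : L₀ ≤ L := by omega
  have hk : 32 ≤ Nat.log 2 L := Nat.le_log_of_pow_le (by norm_num) (hL₀.trans hLL₀)
  have hL1 : 1 ≤ L := by omega
  have hnN : n ≤ 2 ^ L := by
    rw [← Nat.clog_le_iff_le_pow (by norm_num)]
    omega
  have hrun := RAM.runs_reduction (D := hashDim (2 ^ L)) hn hS hx hL hL1 rfl (by
    have := (Nat.mul_le_mul_left _ hk).trans (hashExponent_mul_le L)
    omega) (hashDim_two_pow L)
  have hcost := reduction_cost_le hk
  have hgap := le_two_pow_div_gap (L := L) (by omega)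
  -- Needed for the prime counting bound, which starts at exponent 2.
  have hl2 : 2 ≤ RAM.hashExponent L := by
    rw [RAM.hashExponent, Nat.le_div_iff_mul_le (by omega)]
    have h1 := four_mul_mul_add_five_le_two_pow (k := Nat.log 2 L) (by omega)
    have h2 := Nat.pow_log_le_self 2 (x := L) (by omega)
    nlinarith
  have hN2 : 2 ≤ 2 ^ L := by
    calc 2 = 2 ^ 1 := rfl
      _ ≤ 2 ^ L := Nat.pow_le_pow_right (by norm_num) hL1
  have hsD : 2 ^ RAM.hashExponent L ≤ hashDim (2 ^ L) := by
    rw [hashDim, Nat.log_pow (by norm_num)]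
    exact Nat.pow_le_pow_right (by norm_num) (by omega)
  obtain ⟨hacc, hrej⟩ := hp (2 ^ L) (hashVectors (4 ^ RAM.hashExponent L) _ _ firstTest S₁)
    (hashVectors (4 ^ RAM.hashExponent L) _ _ secondTest S₂)
    (hashVectors (4 ^ RAM.hashExponent L) _ _ thirdTest S₃) (2 ^ RAM.hashExponent L) hN2
    Nat.one_le_two_pow hsD
  set ε' := min ε (1 / 2) with hε'
  have hε2 : ε' ≤ 1 / 2 := min_le_right _ _
  have hNR : (1 : ℝ) ≤ ((2 ^ L : ℕ) : ℝ) := by exact_mod_cast Nat.one_le_two_pow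
  have htime : ∀ t u : ℕ, (t : ℝ) ≤ K * ((2 ^ L : ℕ) : ℝ) ^ (2 - ε) →
      u ≤ 200 * (2 ^ L * (4 ^ RAM.hashExponent L) ^ 4) * (1000 * (6 * L + 4)) + t →
      (u : ℝ) ≤ (4800000 + |K|) * ((2 ^ (L₀ + 1) : ℕ) : ℝ) ^ (2 - ε') * (n : ℝ) ^ (2 - ε') := by
    intro t u ht hu
    have h1 : (u : ℝ) ≤ 4800000 * ((2 ^ L : ℕ) : ℝ) ^ (3 / 2 : ℝ) +
        K * ((2 ^ L : ℕ) : ℝ) ^ (2 - ε) := by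
      refine le_trans (Nat.cast_le.2 hu) ?_
      rw [Nat.cast_add]
      exact add_le_add hcost ht
    have h2 : ((2 ^ L : ℕ) : ℝ) ^ (3 / 2 : ℝ) ≤ ((2 ^ L : ℕ) : ℝ) ^ (2 - ε') :=
      Real.rpow_le_rpow_of_exponent_le hNR (by linarith)
    have h3 : ((2 ^ L : ℕ) : ℝ) ^ (2 - ε) ≤ ((2 ^ L : ℕ) : ℝ) ^ (2 - ε') :=
      Real.rpow_le_rpow_of_exponent_le hNR (by linarith [min_le_left ε (1 / 2 : ℝ)])
    have h4 : K * ((2 ^ L : ℕ) : ℝ) ^ (2 - ε) ≤ |K| * ((2 ^ L : ℕ) : ℝ) ^ (2 - ε') :=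
      mul_le_mul (le_abs_self K) h3 (by positivity) (abs_nonneg K)
    have h5 : ((2 ^ L : ℕ) : ℝ) ≤ ((2 ^ (L₀ + 1) : ℕ) : ℝ) * n := by
      rw [hL]
      exact_mod_cast two_pow_max_clog_le hn
    have h6 : ((2 ^ L : ℕ) : ℝ) ^ (2 - ε') ≤
        ((2 ^ (L₀ + 1) : ℕ) : ℝ) ^ (2 - ε') * (n : ℝ) ^ (2 - ε') := by
      rw [← Real.mul_rpow (by positivity) (by positivity)]
      exact Real.rpow_le_rpow (by positivity) h5 (by linarith)
    calc (u : ℝ) ≤ (4800000 + |K|) * ((2 ^ L : ℕ) : ℝ) ^ (2 - ε') := by nlinarith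
      _ ≤ (4800000 + |K|) * (((2 ^ (L₀ + 1) : ℕ) : ℝ) ^ (2 - ε') * (n : ℝ) ^ (2 - ε')) := by
        gcongr
      _ = _ := by ring
  constructor
  · intro hsol
    obtain ⟨i, j, k, hijk⟩ := exists_primeCounting_le_tripleInner (N := 2 ^ L)
      (hashDim_two_pow L) (by omega) (by omega) (by omega) hsol
    obtain ⟨τ, t, hex, ht, hτ⟩ :=
      hacc ⟨i, j, k, (two_pow_le_primeCounting_four_pow hl2).trans hijk⟩
    obtain ⟨u, hu, hut⟩ := hrun.exec_seq hex
    exact ⟨τ, u, hu, htime t u ht hut, hτ⟩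
  · intro hsol
    obtain ⟨τ, t, hex, ht, hτ⟩ := hrej fun i j k => by
      refine le_trans (Nat.cast_le.2 ?_) hgap
      refine tripleInner_le_of_forall_ne (hashDim_two_pow L) hsol ?_ i j k
      intro x hx₁ y hx₂ z hx₃
      have h1 := hx x (by simp [hx₁])
      have h2 := hx y (by simp [hx₂])
      have h3 := hx z (by simp [hx₃])
      rw [Int.abs_eq_natAbs] at h1 h2 h3
      have h4 : n ^ 6 ≤ (2 ^ L) ^ 6 := Nat.pow_le_pow_left hnN 6
      -- Three summands of size at most `N ^ 6`, with 3 rounded up to 4 to get a power of two.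
      have h5 : (x + y + z).natAbs ≤ 2 ^ (6 * L + 2) := by
        have h6 : 2 ^ (6 * L + 2) = 4 * (2 ^ L) ^ 6 := by
          rw [pow_add, mul_comm 6 L, pow_mul]
          ring
        have h7 : x.natAbs ≤ n ^ 6 := by exact_mod_cast h1
        have h8 : y.natAbs ≤ n ^ 6 := by exact_mod_cast h2
        have h9 : z.natAbs ≤ n ^ 6 := by exact_mod_cast h3
        omega
      calc Nat.log 2 (x + y + z).natAbs ≤ Nat.log 2 (2 ^ (6 * L + 2)) := Nat.log_mono_right h5
        _ = 6 * L + 2 := Nat.log_pow (by norm_num) _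
    obtain ⟨u, hu, hut⟩ := hrun.exec_seq hex
    exact ⟨τ, u, hu, htime t u ht hut, hτ⟩

theorem theorem9 (h : ThreeSumHypothesis) :
    ∃ (D : ℕ → ℕ) (δ η : ℕ → ℝ),
      Tendsto δ atTop (𝓝 0) ∧ Tendsto η atTop (𝓝 0) ∧
      (∀ N : ℕ, 2 ≤ N → (D N : ℝ) = (N : ℝ) ^ δ N) ∧
      ∀ ε : ℝ, 0 < ε →
        ¬ ∃ (p : RAM.Prog) (K : ℝ),
          DistinguishesGapMIP p D
            (fun N => (2 : ℝ) ^ ((Real.logb 2 (N : ℝ)) ^ (1 - η N)))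
            (fun N => K * (N : ℝ) ^ (2 - ε)) := by
  refine ⟨hashDim, dimExponent, gapLoss, tendsto_dimExponent, tendsto_gapLoss,
    fun N => hashDim_eq_rpow, ?_⟩
  rintro ε hε ⟨p, K, hp⟩
  -- `2 ^ 32` makes `Nat.log 2 L` at least 32, as the cost bound requires. `L₀` is kept opaque, so
  -- the huge constant `2 ^ (L₀ + 1)` stays symbolic.
  obtain ⟨L₀, hL₀⟩ : ∃ L₀ : ℕ, 2 ^ 32 ≤ L₀ := ⟨_, le_rfl⟩
  exact h (min ε (1 / 2)) (lt_min hε (by norm_num))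
    ⟨_, _, solvesThreeSum_of_distinguishesGapMIP hp hL₀⟩
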